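/- Let $M$ be a connected (smooth, Hausdorff) manifold of dimension $n\ge 1$, and let $F\colon TM\to\mathbb R$ be a Randers metric on $M$: $F=\alpha+\beta$, where $\alpha$ is the norm of a smooth Riemannian metric $(\alpha_{ij})$ (also denoted $\alpha$), $\beta$ is a smooth $1$-form, and $F$ is a Finsler metric, i.e. $F$ is continuous on $TM$, smooth off the zero section, positively homogeneous of degree one, and the vertical Hessian of $F^2/2$ is positive definite at every nonzero tangent vector. Suppose that $F$ is non-Riemannian, i.e. $F$ is not the norm of a smooth Riemannian metric. A (smooth) linear connection $\nabla$ on $M$ is called *compatible* (with $F$) if its parallel transports preserve $F$, i.e. $F$ is constant along every parallel vector field along a smooth curve. For a linear connection with torsion $T$, put $\|T_p\|^2=\sum_{i<j}\sum_k (T_{ij}^k)^2$, the components being taken in an $\alpha$-orthonormal basis of $T_pM$ (the value is independent of the basis). A compatible linear connection is called *extremal* if at each point $p$ its torsion has the smallest norm $\|T_p\|$ among the torsions at $p$ of all compatible linear connections. 1. A compatible linear connection exists on $M$ if and only if the vector field $\beta^\sharp$ dual to $\beta$ with respect to $\alpha$ has positive constant $\alpha$-length. 2. In that case the extremal compatible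 linear connection $\nabla$ exists and is unique. Let $p\in M$ and let $u^1,\dots,u^n$ be local coordinates around $p$ such that $(\partial/\partial u^1)_p,\dots,(\partial/\partial u^n)_p$ is an $\alpha$-orthonormal basis of $T_pM$, $\beta_1(p)=\dots=\beta_{n-1}(p)=0$ and $\beta_n(p)\ne 0$, where $\beta_i=\beta(\partial/\partial u^i)$. Let $\Gamma_{ij}^k$ and $\Gamma_{ij}^{*k}$ be the connection parameters of $\nabla$ and of the Levi-Civita connection $\nabla^*$ of $\alpha$ (so $\nabla_{\partial_i}\partial_j=\Gamma_{ij}^k\partial_k$), and $T_{ij}^k=\Gamma_{ij}^k-\Gamma_{ji}^k$ the torsion components of $\nabla$. Then, all functions being evaluated at $p$ and $\partial_i=\partial/\partial u^i$, $$\Gamma_{ij}^r=\Gamma_{ij}^{*r}-\tfrac12\left(T_{jr}^i+T_{ir}^j-T_{ij}^r\right)\qquad(i,j,r=1,\dots,n),$$ and - $T_{ab}^c=0$ for $a<b<n$ and $c<n$; - $T_{ab}^n=\dfrac1{\beta_n}\left(\partial_a\beta_b-\partial_b\beta_a\right)$ for $a<b<n$; - $T_{an}^a=\Gamma_{aa}^{*n}-\dfrac1{\beta_n}\,\partial_a\beta_a$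 for $a<n$; - $T_{an}^n=\Gamma_{an}^{*n}-\dfrac1{\beta_n}\,\partial_n\beta_a$ for $a<n$; - $T_{an}^c=\Gamma_{ac}^{*n}-\dfrac1{2\beta_n}\left(\partial_a\beta_c+\partial_c\beta_a\right)$ for $a,c<n$, $a\ne c$. -/

import Mathlib

open Bundle Set
open scoped Manifold ContDiff Topology

noncomputable section

namespace RandersGB

variable {n : ℕ} {M : Type*} [TopologicalSpace M] [ChartedSpace (EuclideanSpace ℝ (Fin n)) M]

/-- Linear (affine) connections on `M`: covariant derivatives on the tangent bundle. Following
Mathlib's argument order, `nabla Y x v` is `(∇_v Y)(x)`. Smoothness is a separate condition. -/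
abbrev LinConn (n : ℕ) (M : Type*) [TopologicalSpace M]
    [ChartedSpace (EuclideanSpace ℝ (Fin n)) M] [IsManifold (𝓡 n) ∞ M] :=
  CovariantDerivative (𝓡 n) (EuclideanSpace ℝ (Fin n)) (TangentSpace (𝓡 n) : M → Type _)

/-! ### Local coordinates -/

/-- The `i`-th coordinate `y^i(v)` of a tangent vector `v` at `x` in the local coordinates `e`. -/
def coord (e : OpenPartialHomeomorph M (EuclideanSpace ℝ (Fin n))) {x : M}
    (v : TangentSpace (𝓡 n) x) (i : Fin n) : ℝ :=
  (show EuclideanSpace ℝ (Fin n) from mfderiv (𝓡 n) (𝓡 n) e x v) i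

/-- The coordinate vector field `∂/∂u^i` of the local coordinates `e` (meaningful on `e.source`):
the pullback by `e` of the `i`-th standard basis vector. -/
def coordField (e : OpenPartialHomeomorph M (EuclideanSpace ℝ (Fin n))) (i : Fin n) (x : M) :
    TangentSpace (𝓡 n) x :=
  VectorField.mpullback (𝓡 n) (𝓡 n) e
    (fun _ ↦ (EuclideanSpace.single i (1 : ℝ) : EuclideanSpace ℝ (Fin n))) x

/-- The partial derivative `∂f/∂u^i` at `p` of a function `f` in the local coordinates `e`. -/
def partialDeriv (e : OpenPartialHomeomorph M (EuclideanSpace ℝ (Fin n))) (i : Fin n)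
    (f : M → ℝ) (p : M) : ℝ :=
  fderiv ℝ (fun z ↦ f (e.symm z)) (e p) (EuclideanSpace.single i 1)

/-- The component `β_i = β(∂/∂u^i)` of a 1-form. -/
def formComp (e : OpenPartialHomeomorph M (EuclideanSpace ℝ (Fin n)))
    (β : ∀ x : M, TangentSpace (𝓡 n) x →L[ℝ] ℝ) (i : Fin n) (x : M) : ℝ :=
  β x (coordField e i x)

/-- The connection parameter `Γ_{ij}^k`, the `k`-th coordinate of `∇_{∂_i} ∂_j`. -/
def connParam [IsManifold (𝓡 n) ∞ M] (e : OpenPartialHomeomorph M (EuclideanSpace ℝ (Fin n)))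
    (nabla : LinConn n M) (i j k : Fin n) (x : M) : ℝ :=
  coord e (nabla (coordField e j) x (coordField e i x)) k

/-- The torsion component `T_{ij}^k`, the `k`-th coordinate of `T(∂_i, ∂_j)`. -/
def torsionComp [IsManifold (𝓡 n) ∞ M] (e : OpenPartialHomeomorph M (EuclideanSpace ℝ (Fin n)))
    (nabla : LinConn n M) (i j k : Fin n) (x : M) : ℝ :=
  coord e (nabla.torsion x (coordField e i x) (coordField e j x)) k

/-! ### Finsler metrics and compatible linear connections -/

/-- Finsler metrics: continuous on `TM`, smooth off the zero section, positively homogeneous of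
degree one, with positive definite vertical Hessian of the energy `F²/2` at nonzero vectors. The
Hessian at `v` is evaluated on the pair `(w, w)` as a second derivative along the line `v + s w`. -/
structure IsFinslerMetric [IsManifold (𝓡 n) ∞ M] (F : TangentBundle (𝓡 n) M → ℝ) : Prop where
  continuous : Continuous F
  smooth : ContMDiffOn (𝓡 n).tangent 𝓘(ℝ, ℝ) ∞ F {v | v.2 ≠ 0}
  homogeneous : ∀ (x : M) (v : TangentSpace (𝓡 n) x) (t : ℝ), 0 < t →
    F ⟨x, t • v⟩ = t * F ⟨x, v⟩
  convex : ∀ (x : M) (v w : TangentSpace (𝓡 n) x), v ≠ 0 → w ≠ 0 →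
    0 < iteratedDeriv 2 (fun s : ℝ ↦ F ⟨x, v + s • w⟩ ^ 2 / 2) 0

/-- `F` is Riemannian if it is the norm of a smooth Riemannian metric. -/
def IsRiemannianNorm [IsManifold (𝓡 n) ∞ M] (F : TangentBundle (𝓡 n) M → ℝ) : Prop :=
  ∃ g : ContMDiffRiemannianMetric (𝓡 n) ∞ (EuclideanSpace ℝ (Fin n))
      (fun x : M ↦ TangentSpace (𝓡 n) x),
    ∀ (x : M) (v : TangentSpace (𝓡 n) x), F ⟨x, v⟩ = √(g.inner x v v)

/-- The vector field `X` along `c : [0,1] → M` is parallel: its coordinates solve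
`(X^k)' = - ∑ (c^i)' X^j Γ_{ij}^k ∘ c`. The equation at a given parameter value is invariant under
changes of coordinates, so it is asked for in some coordinate system around the point. -/
def IsParallelAlong [IsManifold (𝓡 n) ∞ M] (nabla : LinConn n M) (c : ℝ → M)
    (X : ∀ t : ℝ, TangentSpace (𝓡 n) (c t)) : Prop :=
  ∀ t ∈ Icc (0 : ℝ) 1, ∃ e ∈ IsManifold.maximalAtlas (𝓡 n) ∞ M, c t ∈ e.source ∧
    ∀ k : Fin n, HasDerivWithinAt (fun s ↦ coord e (X s) k)
      (-∑ i : Fin n, ∑ j : Fin n, derivWithin (fun s ↦ (e (c s)) i) (Icc 0 1) t *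
        coord e (X t) j * connParam e nabla i j k (c t)) (Icc 0 1) t

/-- A compatible linear connection: a smooth linear connection whose parallel transports along
smooth curves preserve the Finslerian length of tangent vectors. -/
structure IsCompatible [IsManifold (𝓡 n) ∞ M] (nabla : LinConn n M)
    (F : TangentBundle (𝓡 n) M → ℝ) : Prop where
  smooth : nabla.ContMDiffCovariantDerivative ∞
  parallel : ∀ (c : ℝ → M) (X : ∀ t : ℝ, TangentSpace (𝓡 n) (c t)),
    ContMDiffOn 𝓘(ℝ, ℝ) (𝓡 n) ∞ c (Icc 0 1) → IsParallelAlong nabla c X →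
    ∀ t ∈ Icc (0 : ℝ) 1, F ⟨c t, X t⟩ = F ⟨c 0, X 0⟩

/-! ### The Riemannian part and Randers metrics

The Riemannian metric `α` is the Riemannian structure of the tangent bundle. -/

theorem finiteDimensional_tangent (x : M) : FiniteDimensional ℝ (TangentSpace (𝓡 n) x) :=
  inferInstanceAs (FiniteDimensional ℝ (EuclideanSpace ℝ (Fin n)))

section Riemannian

variable [IsManifold (𝓡 n) ∞ M] [RiemannianBundle (fun x : M ↦ TangentSpace (𝓡 n) x)]

/-- `F = α + β` is a Randers metric with Riemannian part the ambient Riemannian metric. -/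
structure IsRandersMetric (F : TangentBundle (𝓡 n) M → ℝ)
    (β : ∀ x : M, TangentSpace (𝓡 n) x →L[ℝ] ℝ) : Prop where
  finsler : IsFinslerMetric F
  smooth_form : ContMDiff (𝓡 n) ((𝓡 n).prod 𝓘(ℝ, EuclideanSpace ℝ (Fin n) →L[ℝ] ℝ)) ∞
    (fun x ↦ TotalSpace.mk' (EuclideanSpace ℝ (Fin n) →L[ℝ] ℝ)
      (E := fun x : M ↦ TangentSpace (𝓡 n) x →L[ℝ] ℝ) x (β x))
  eq_add : ∀ (x : M) (v : TangentSpace (𝓡 n) x), F ⟨x, v⟩ = ‖v‖ + β x v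

theorem completeSpace_tangent (x : M) : CompleteSpace (TangentSpace (𝓡 n) x) :=
  haveI := finiteDimensional_tangent (n := n) x
  FiniteDimensional.complete ℝ (TangentSpace (𝓡 n) x)

/-- The vector field dual to the 1-form `β`: `⟪sharp β x, v⟫ = β x v`. -/
def sharp (β : ∀ x : M, TangentSpace (𝓡 n) x →L[ℝ] ℝ) (x : M) : TangentSpace (𝓡 n) x :=
  haveI := completeSpace_tangent (n := n) x
  (InnerProductSpace.toDual ℝ (TangentSpace (𝓡 n) x)).symm (β x)

/-- The norm of the torsion at `p`: the square root of the sum of the squares of the components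
`T_{ij}^k`, `i < j`, in an orthonormal basis of the tangent space (the value does not depend on
the basis). -/
def torsionNorm (nabla : LinConn n M) (p : M) : ℝ :=
  haveI := finiteDimensional_tangent (n := n) p
  let b := stdOrthonormalBasis ℝ (TangentSpace (𝓡 n) p)
  √(∑ i, ∑ j ∈ Finset.Ioi i, ∑ k, inner ℝ (nabla.torsion p (b i) (b j)) (b k) ^ 2)

/-- An extremal compatible linear connection: the pointwise norm of its torsion is minimal among
all compatible linear connections. -/
structure IsExtremal (nabla : LinConn n M) (F : TangentBundle (𝓡 n) M → ℝ) : Prop where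
  compatible : IsCompatible nabla F
  minimal : ∀ nabla' : LinConn n M, IsCompatible nabla' F →
    ∀ p : M, torsionNorm nabla p ≤ torsionNorm nabla' p

set_option synthInstance.maxHeartbeats 400000 in
/-- The Levi-Civita connection: metric and torsion-free. -/
structure IsLeviCivita
    [IsContMDiffRiemannianBundle (𝓡 n) ∞ (EuclideanSpace ℝ (Fin n))
      (fun x : M ↦ TangentSpace (𝓡 n) x)] (D : LinConn n M) : Prop where
  metric : D.IsMetricCompatible
  torsion_free : D.torsion = 0

end Riemannian

/-- Coordinates `e` around `p` adapted to the Randers metric: the coordinate vectors at `p` are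
orthonormal for the Riemannian part, and all components of `β` at `p` but the last one vanish. -/
structure IsAdapted {m : ℕ} {M : Type*} [TopologicalSpace M]
    [ChartedSpace (EuclideanSpace ℝ (Fin (m + 1))) M] [IsManifold (𝓡 (m + 1)) ∞ M]
    [RiemannianBundle (fun x : M ↦ TangentSpace (𝓡 (m + 1)) x)]
    (e : OpenPartialHomeomorph M (EuclideanSpace ℝ (Fin (m + 1))))
    (β : ∀ x : M, TangentSpace (𝓡 (m + 1)) x →L[ℝ] ℝ) (p : M) : Prop where
  mem_atlas : e ∈ IsManifold.maximalAtlas (𝓡 (m + 1)) ∞ M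
  mem_source : p ∈ e.source
  orthonormal : Orthonormal ℝ (fun i : Fin (m + 1) ↦ coordField e i p)
  formComp_eq_zero : ∀ a : Fin m, formComp e β a.castSucc p = 0
  formComp_last_ne_zero : formComp e β (Fin.last m) p ≠ 0

end RandersGB

end

open RandersGB

/-!
Write `F(v) = √⟪v, v⟫ + ⟪β♯, v⟫`. If `X` is parallel along a curve then so is `-X`, hence a
compatible connection keeps both `⟪X, X⟫` and `⟪β♯, X⟫` constant; as parallel fields exist with
arbitrary initial data, compatible connections are exactly the smooth metric connections with
`∇β♯ = 0`. For such a connection `⟪β♯, β♯⟫` is constant, and it does not vanish unless `F` is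
Riemannian.

Two compatible connections differ at a point by a tensor `A`, `∇'_u Y = ∇_u Y + A(Y, u)`, such that
`⟪A(v, u), w⟫` is skew in `v, w` and `A(β♯, u) = 0`. The torsion changes by the alternation of `A`,
and `A` is determined by its alternation, so by Pythagoras the torsion `T` of a compatible
connection is the unique shortest one as soon as it is orthogonal to all such alternations. This
is the case if `⟪T(u, v), w⟫` vanishes for `u, v, w ∈ β♯ᗮ` and `⟪T(β♯, v), w⟫` is symmetric in
`v, w ∈ β♯ᗮ`. When `β♯` has constant positive length, solving these linear conditions for the
difference from the Levi-Civita connection gives an explicit smooth tensor, hence the extremal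
connection; evaluated on an adapted basis they give its torsion components.
-/

noncomputable section

namespace RandersGB

/-! ### Smoothness of sections of a Riemannian vector bundle -/

section Smoothness

variable {E : Type*} [NormedAddCommGroup E] [NormedSpace ℝ E] {H : Type*} [TopologicalSpace H]
  {I : ModelWithCorners ℝ E H} {M : Type*} [TopologicalSpace M] [ChartedSpace H M]
  {F : Type*} [NormedAddCommGroup F] [NormedSpace ℝ F]
  {ι : Type*} {b : Module.Basis ι ℝ F} {k : ℕ∞ω} {x x₀ : M}

theorem contMDiffAt_clm_of_basis [Finite ι] (b : Module.Basis ι ℝ F)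
    {G : Type*} [NormedAddCommGroup G] [NormedSpace ℝ G] {f : M → F →L[ℝ] G}
    (hf : ∀ i, CMDiffAt k (fun y ↦ f y (b i)) x) : CMDiffAt k f x := by
  cases nonempty_fintype ι
  have := Module.Basis.finiteDimensional_of_finite b
  have sum_coord : f = fun y ↦ ∑ i, ContinuousLinearMap.smulRightL ℝ F G
      (LinearMap.toContinuousLinearMap (b.coord i)) (f y (b i)) := by
    funext y
    refine ContinuousLinearMap.coe_injective (b.ext fun j ↦ ?_)
    classical simp [Finsupp.single_apply, ite_smul]
  rw [sum_coord]
  exact ContMDiffAt.sum fun i _ ↦ (ContinuousLinearMap.contMDiff _).contMDiffAt.comp x (hf i)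

variable {V : M → Type*} [TopologicalSpace (TotalSpace F V)]

theorem symmL_basis [∀ x, AddCommGroup (V x)] [∀ x, Module ℝ (V x)] [∀ x, TopologicalSpace (V x)]
    [FiberBundle F V] [VectorBundle ℝ F V]
    {e : Trivialization F (TotalSpace.proj : TotalSpace F V → M)} [MemTrivializationAtlas e]
    (hx : x ∈ e.baseSet) (i : ι) : e.symmL ℝ x (b i) = e.localFrame b i x := by
  rw [e.localFrame_apply_of_mem_baseSet b hx, Trivialization.basisAt, Module.Basis.map_apply,
    e.symmL_apply hx]
  rfl

theorem contMDiffAt_hom_of_localFrame [Finite ι] [∀ x, AddCommGroup (V x)] [∀ x, Module ℝ (V x)]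
    [∀ x, TopologicalSpace (V x)] [FiberBundle F V] [VectorBundle ℝ F V]
    {F' : Type*} [NormedAddCommGroup F'] [NormedSpace ℝ F'] {V' : M → Type*}
    [TopologicalSpace (TotalSpace F' V')] [∀ x, AddCommGroup (V' x)] [∀ x, Module ℝ (V' x)]
    [∀ x, TopologicalSpace (V' x)] [∀ x, IsTopologicalAddGroup (V' x)]
    [∀ x, ContinuousSMul ℝ (V' x)] [FiberBundle F' V'] [VectorBundle ℝ F' V']
    (b : Module.Basis ι ℝ F) {A : ∀ x, V x →L[ℝ] V' x}
    (hA : ∀ i, CMDiffAt k (T% (fun y ↦ A y ((trivializationAt F V x).localFrame b i y))) x) :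
    ContMDiffAt I (I.prod 𝓘(ℝ, F →L[ℝ] F')) k
      (fun y ↦ TotalSpace.mk' (F →L[ℝ] F') (E := fun y ↦ V y →L[ℝ] V' y) y (A y)) x := by
  refine (contMDiffAt_hom_bundle _).2 ⟨contMDiffAt_id, contMDiffAt_clm_of_basis b fun i ↦ ?_⟩
  refine ((contMDiffAt_section x).1 (hA i)).congr_of_eventuallyEq ?_
  filter_upwards [
    (trivializationAt F V x).open_baseSet.mem_nhds (FiberBundle.mem_baseSet_trivializationAt F V x),
    (trivializationAt F' V' x).open_baseSet.mem_nhds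
      (FiberBundle.mem_baseSet_trivializationAt F' V' x)] with y hy hy'
  simp only [ContinuousLinearMap.inCoordinates, ContinuousLinearMap.comp_apply, symmL_basis hy,
    Trivialization.continuousLinearMapAt_apply, Trivialization.coe_linearMapAt_of_mem _ hy']

section Riemannian

variable [∀ x, NormedAddCommGroup (V x)] [∀ x, InnerProductSpace ℝ (V x)] [FiberBundle F V]
  [VectorBundle ℝ F V] (e : Trivialization F (TotalSpace.proj : TotalSpace F V → M))
  [MemTrivializationAtlas e]

/-- The fibre metric of a Riemannian vector bundle read in the trivialization `e`, as a map from
the model fibre to its dual (meaningful over `e.baseSet`). -/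
def localMetric (x : M) : F →L[ℝ] F →L[ℝ] ℝ :=
  (innerSL ℝ (E := V x)).bilinearComp (e.symmL ℝ x) (e.symmL ℝ x)

theorem localMetric_apply (x : M) (v w : F) :
    localMetric e x v w = inner ℝ (e.symmL ℝ x v) (e.symmL ℝ x w) := rfl

variable {e}

theorem isInvertible_localMetric [FiniteDimensional ℝ F] (hx : x ∈ e.baseSet) :
    (localMetric e x).IsInvertible := by
  have injective : Function.Injective (localMetric e x) := by
    refine (injective_iff_map_eq_zero _).2 fun v hv ↦ ?_
    have symmL_eq_zero : e.symmL ℝ x v = 0 := by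
      rw [← inner_self_eq_zero (𝕜 := ℝ), ← localMetric_apply, hv, zero_apply]
    rw [← e.continuousLinearMapAt_symmL (R := ℝ) hx v, symmL_eq_zero, map_zero]
  have finrank_eq : Module.finrank ℝ F = Module.finrank ℝ (F →L[ℝ] ℝ) :=
    Subspace.dual_finrank_eq.symm.trans (LinearMap.toContinuousLinearMap (𝕜 := ℝ)).finrank_eq
  exact ⟨(LinearEquiv.ofInjectiveOfFinrankEq (localMetric e x).toLinearMap injective
    finrank_eq).toContinuousLinearEquiv, rfl⟩

variable [ContMDiffVectorBundle k F V I] [IsContMDiffRiemannianBundle I k F V]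

theorem contMDiffAt_localMetric [FiniteDimensional ℝ F] (hx : x ∈ e.baseSet) :
    CMDiffAt k (localMetric e) x := by
  let b := Module.finBasis ℝ F
  refine contMDiffAt_clm_of_basis b fun i ↦ contMDiffAt_clm_of_basis b fun j ↦ ?_
  refine ((contMDiffAt_localFrame_of_mem k e b i hx).inner_bundle
    (contMDiffAt_localFrame_of_mem k e b j hx)).congr_of_eventuallyEq ?_
  filter_upwards [e.open_baseSet.mem_nhds hx] with y hy
  rw [localMetric_apply, symmL_basis hy, symmL_basis hy]

theorem contMDiffAt_of_inner_localFrame [Finite ι] (b : Module.Basis ι ℝ F) {W : ∀ x, V x}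
    (hW : ∀ i, CMDiffAt k (fun y ↦ inner ℝ (W y) ((trivializationAt F V x).localFrame b i y)) x) :
    CMDiffAt k (T% W) x := by
  have := Module.Basis.finiteDimensional_of_finite b
  set e := trivializationAt F V x
  have hx : x ∈ e.baseSet := FiberBundle.mem_baseSet_trivializationAt F V x
  have hdual : CMDiffAt k (fun y ↦ (innerSL ℝ (W y)).comp (e.symmL ℝ y)) x := by
    refine contMDiffAt_clm_of_basis b fun i ↦ (hW i).congr_of_eventuallyEq ?_
    filter_upwards [e.open_baseSet.mem_nhds hx] with y hy
    rw [ContinuousLinearMap.comp_apply, innerSL_apply_apply, symmL_basis hy]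
  have hinverse : CMDiffAt k (fun y ↦ (localMetric e y).inverse) x :=
    (isInvertible_localMetric hx).contDiffAt_map_inverse.contMDiffAt.comp x
      (contMDiffAt_localMetric hx)
  refine (contMDiffAt_section x).2 ((hinverse.clm_apply hdual).congr_of_eventuallyEq ?_)
  filter_upwards [e.open_baseSet.mem_nhds hx] with y hy
  refine ((isInvertible_localMetric hy).inverse_apply_eq.2 ?_).symm
  have symmL_coord : e.symmL ℝ y (e ⟨y, W y⟩).2 = W y := by
    rw [e.symmL_apply hy, e.symm_apply_apply_mk hy]
  ext v
  rw [localMetric_apply, ContinuousLinearMap.comp_apply, innerSL_apply_apply, symmL_coord]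

end Riemannian

theorem exists_contMDiff_eventuallyEq [FiniteDimensional ℝ E] [IsManifold I ∞ M] [T2Space M]
    [∀ x, AddCommGroup (V x)] [∀ x, Module ℝ (V x)] [∀ x, TopologicalSpace (V x)]
    [FiberBundle F V] [VectorBundle ℝ F V] {Y : ∀ x, V x}
    (hY : ∀ᶠ y in 𝓝 x, CMDiffAt ∞ (T% Y) y) :
    ∃ Z : ∀ x, V x, CMDiff ∞ (T% Z) ∧ ∀ᶠ y in 𝓝 x, Y y = Z y := by
  obtain ⟨v, hv, isOpen_v, hxv⟩ := eventually_nhds_iff.1 hY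
  obtain ⟨f, -, hf⟩ := (SmoothBumpFunction.nhds_basis_tsupport (I := I) x).mem_iff.1
    (isOpen_v.mem_nhds hxv)
  refine ⟨(f : M → ℝ) • Y, ?_, ?_⟩
  · exact ContMDiffOn.smul_section_of_tsupport f.contMDiff.contMDiffOn isOpen_v hf
      fun y hy ↦ (hv y hy).contMDiffWithinAt
  · filter_upwards [f.eventuallyEq_one] with y hy
    simp [hy]

end Smoothness

/-! ### The Levi-Civita connection -/

section LeviCivita

open VectorField

variable {E : Type*} [NormedAddCommGroup E] [NormedSpace ℝ E] {H : Type*} [TopologicalSpace H]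
  {I : ModelWithCorners ℝ E H} {M : Type*} [TopologicalSpace M] [ChartedSpace H M]

instance finiteDimensional_tangentSpace [FiniteDimensional ℝ E] (x : M) :
    FiniteDimensional ℝ (TangentSpace I x) :=
  inferInstanceAs (FiniteDimensional ℝ E)

theorem contMDiffAt_covariantDerivative [FiniteDimensional ℝ E] [IsManifold I ∞ M] [T2Space M]
    {F : Type*} [NormedAddCommGroup F] [NormedSpace ℝ F] {V : M → Type*}
    [TopologicalSpace (TotalSpace F V)] [∀ x, AddCommGroup (V x)] [∀ x, Module ℝ (V x)]
    [∀ x, TopologicalSpace (V x)] [∀ x, IsTopologicalAddGroup (V x)]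
    [∀ x, ContinuousSMul ℝ (V x)] [FiberBundle F V] [VectorBundle ℝ F V]
    [ContMDiffVectorBundle 1 F V I] {nabla : CovariantDerivative I F V}
    (hs : nabla.ContMDiffCovariantDerivative ∞) {Y : ∀ x, V x} {x : M}
    (hY : ∀ᶠ y in 𝓝 x, CMDiffAt ∞ (T% Y) y) :
    ContMDiffAt I (I.prod 𝓘(ℝ, E →L[ℝ] F)) ∞
      (fun y ↦ TotalSpace.mk' (E →L[ℝ] F) (E := fun y ↦ TangentSpace I y →L[ℝ] V y) y
        (nabla Y y)) x := by
  obtain ⟨Z, hZ, hYZ⟩ := exists_contMDiff_eventuallyEq hY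
  refine ((hs.contMDiff.contMDiff (σ := Z) hZ.contMDiffOn).contMDiffAt
    Filter.univ_mem).congr_of_eventuallyEq ?_
  filter_upwards [hYZ.eventually_nhds, hY] with y hYZy hYy
  rw [nabla.isCovariantDerivativeOnUniv.congr_of_eventuallyEq (hYy.mdifferentiableAt (by simp))
    (hZ.contMDiffAt.mdifferentiableAt (by simp)) Filter.univ_mem hYZy]

/-- The endomorphism that represents a bilinear form on a finite-dimensional inner product space. -/
def rieszMap {W : Type*} [NormedAddCommGroup W] [InnerProductSpace ℝ W] [FiniteDimensional ℝ W]
    (B : W →L[ℝ] W →L[ℝ] ℝ) : W →L[ℝ] W :=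
  haveI := FiniteDimensional.complete ℝ W
  LinearMap.toContinuousLinearMap
    { toFun := fun v ↦ (InnerProductSpace.toDual ℝ W).symm (B v)
      map_add' := fun v w ↦ by rw [map_add, map_add]
      map_smul' := fun c v ↦ by simp only [map_smul, RingHom.id_apply] }

theorem inner_rieszMap {W : Type*} [NormedAddCommGroup W] [InnerProductSpace ℝ W]
    [FiniteDimensional ℝ W] (B : W →L[ℝ] W →L[ℝ] ℝ) (v w : W) :
    inner ℝ (rieszMap B v) w = B v w :=
  haveI := FiniteDimensional.complete ℝ W
  InnerProductSpace.toDual_symm_apply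

theorem contMDiffAt_mvfderiv [IsManifold I ∞ M] {X : ∀ x : M, TangentSpace I x} {x : M}
    {f : M → ℝ} (hf : CMDiffAt ∞ f x) (hX : CMDiffAt ∞ (T% X) x) :
    CMDiffAt ∞ (fun y ↦ mvfderiv I f y (X y)) x :=
  have hfX : ContMDiffAt I 𝓘(ℝ, ℝ).tangent ∞
      (fun y ↦ (⟨f y, mfderiv I 𝓘(ℝ, ℝ) f y (X y)⟩ : TangentBundle 𝓘(ℝ, ℝ) ℝ)) x :=
    ContMDiffAt.clm_apply_of_inCoordinates (b₁ := id) (hf.mfderiv_const (m := ∞) (by simp)) hX hf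
  (contMDiff_snd_tangentBundle_modelSpace ℝ 𝓘(ℝ, ℝ)).contMDiffAt.comp x hfX

variable {X X' Y Y' Z Z' : ∀ x : M, TangentSpace I x} {f : M → ℝ} {x : M}

theorem hom_eq_of_fields [IsManifold I ∞ M] {A B : TangentSpace I x →L[ℝ] TangentSpace I x}
    (h : ∀ X : ∀ x : M, TangentSpace I x, MDiffAt (T% X) x → A (X x) = B (X x)) : A = B :=
  ContinuousLinearMap.ext fun v ↦ by
    simpa only [FiberBundle.extend_apply_self] using
      h _ (FiberBundle.mdifferentiableAt_extend I E v)

variable [RiemannianBundle (fun x : M ↦ TangentSpace I x)]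

theorem eq_of_inner_fields [IsManifold I ∞ M] {v w : TangentSpace I x}
    (h : ∀ Z : ∀ x : M, TangentSpace I x, MDiffAt (T% Z) x →
      inner ℝ v (Z x) = inner ℝ w (Z x)) : v = w :=
  ext_inner_right ℝ fun u ↦ by
    simpa only [FiberBundle.extend_apply_self] using
      h _ (FiberBundle.mdifferentiableAt_extend I E u)

/-- Half the right-hand side of the Koszul formula for `2 ⟪∇_X Y, Z⟫`. -/
def koszul (X Y Z : ∀ x : M, TangentSpace I x) (x : M) : ℝ :=
  1 / 2 * (mvfderiv I (fun y ↦ inner ℝ (Y y) (Z y)) x (X x)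
    + mvfderiv I (fun y ↦ inner ℝ (X y) (Z y)) x (Y x)
    - mvfderiv I (fun y ↦ inner ℝ (X y) (Y y)) x (Z x)
    + inner ℝ (mlieBracket I X Y x) (Z x)
    - inner ℝ (mlieBracket I X Z x) (Y x)
    - inner ℝ (mlieBracket I Y Z x) (X x))

theorem koszul_add_koszul_swap :
    koszul X Y Z x + koszul X Z Y x = mvfderiv I (fun y ↦ inner ℝ (Y y) (Z y)) x (X x) := by
  simp only [koszul, real_inner_comm (Y _) (Z _), mlieBracket_swap_apply (V := Z) (W := Y),
    inner_neg_left]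
  ring

theorem koszul_sub_koszul_swap :
    koszul X Y Z x - koszul Y X Z x = inner ℝ (mlieBracket I X Y x) (Z x) := by
  simp only [koszul, real_inner_comm (X _) (Y _), mlieBracket_swap_apply (V := Y) (W := X),
    inner_neg_left]
  ring

variable [IsManifold I ∞ M] [IsContMDiffRiemannianBundle I ∞ E (fun x : M ↦ TangentSpace I x)]

instance isContMDiffRiemannianBundle_one :
    IsContMDiffRiemannianBundle I 1 E (fun x : M ↦ TangentSpace I x) :=
  IsContMDiffRiemannianBundle.of_le (n := ∞) (by simp)

theorem mdifferentiableAt_inner (hX : MDiffAt (T% X) x) (hY : MDiffAt (T% Y) x) :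
    MDiffAt (fun y ↦ inner ℝ (X y) (Y y)) x :=
  MDifferentiableAt.inner_bundle hX hY

theorem contMDiffAt_inner (hX : CMDiffAt ∞ (T% X) x) (hY : CMDiffAt ∞ (T% Y) x) :
    CMDiffAt ∞ (fun y ↦ inner ℝ (X y) (Y y)) x :=
  ContMDiffAt.inner_bundle hX hY

section Tensorial

variable [CompleteSpace E]

theorem koszul_add_mid (hX : MDiffAt (T% X) x) (hY : MDiffAt (T% Y) x) (hY' : MDiffAt (T% Y') x)
    (hZ : MDiffAt (T% Z) x) :
    koszul X (Y + Y') Z x = koszul X Y Z x + koszul X Y' Z x := by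
  simp only [koszul, Pi.add_apply, inner_add_left, inner_add_right,
    mvfderiv_fun_add (mdifferentiableAt_inner hY hZ) (mdifferentiableAt_inner hY' hZ),
    mvfderiv_fun_add (mdifferentiableAt_inner hX hY) (mdifferentiableAt_inner hX hY'),
    mlieBracket_add_right hY hY', mlieBracket_add_left hY hY', add_apply, map_add]
  ring

theorem koszul_smul_mid (hf : MDiffAt f x) (hX : MDiffAt (T% X) x) (hY : MDiffAt (T% Y) x)
    (hZ : MDiffAt (T% Z) x) :
    koszul X (f • Y) Z x = f x * koszul X Y Z x
      + mvfderiv I f x (X x) * inner ℝ (Y x) (Z x) := by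
  simp [koszul, inner_smul_right, mvfderiv_fun_mul hf (mdifferentiableAt_inner hY hZ),
    mvfderiv_fun_mul hf (mdifferentiableAt_inner hX hY), inner_smul_left, inner_add_left,
    mlieBracket_smul_right hf hY, mlieBracket_smul_left hf hY, real_inner_comm (X x) (Y x)]
  ring

theorem koszul_add_left (hX : MDiffAt (T% X) x) (hX' : MDiffAt (T% X') x)
    (hY : MDiffAt (T% Y) x) (hZ : MDiffAt (T% Z) x) :
    koszul (X + X') Y Z x = koszul X Y Z x + koszul X' Y Z x := by
  have hbracket := congrArg (inner ℝ · (Z x)) (mlieBracket_add_left (W := Y) hX hX')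
  simp only [inner_add_left, ← koszul_sub_koszul_swap] at hbracket
  linear_combination hbracket + koszul_add_mid hY hX hX' hZ

theorem koszul_smul_left (hf : MDiffAt f x) (hX : MDiffAt (T% X) x) (hY : MDiffAt (T% Y) x)
    (hZ : MDiffAt (T% Z) x) : koszul (f • X) Y Z x = f x * koszul X Y Z x := by
  have hbracket := congrArg (inner ℝ · (Z x)) (mlieBracket_smul_left (W := Y) hf hX)
  simp only [inner_add_left, real_inner_smul_left, ← koszul_sub_koszul_swap] at hbracket
  linear_combination hbracket + koszul_smul_mid hf hY hX hZ

theorem koszul_add_right (hX : MDiffAt (T% X) x) (hY : MDiffAt (T% Y) x)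
    (hZ : MDiffAt (T% Z) x) (hZ' : MDiffAt (T% Z') x) :
    koszul X Y (Z + Z') x = koszul X Y Z x + koszul X Y Z' x := by
  have hderiv : mvfderiv I (fun y ↦ inner ℝ (Y y) ((Z + Z') y)) x (X x)
      = mvfderiv I (fun y ↦ inner ℝ (Y y) (Z y)) x (X x)
        + mvfderiv I (fun y ↦ inner ℝ (Y y) (Z' y)) x (X x) := by
    simp only [Pi.add_apply, inner_add_right, mvfderiv_fun_add (mdifferentiableAt_inner hY hZ)
      (mdifferentiableAt_inner hY hZ'), add_apply]
  simp only [← koszul_add_koszul_swap] at hderiv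
  linear_combination hderiv - koszul_add_mid hX hZ hZ' hY

theorem koszul_smul_right (hf : MDiffAt f x) (hX : MDiffAt (T% X) x) (hY : MDiffAt (T% Y) x)
    (hZ : MDiffAt (T% Z) x) : koszul X Y (f • Z) x = f x * koszul X Y Z x := by
  have hderiv : mvfderiv I (fun y ↦ inner ℝ (Y y) ((f • Z) y)) x (X x)
      = f x * mvfderiv I (fun y ↦ inner ℝ (Y y) (Z y)) x (X x)
        + mvfderiv I f x (X x) * inner ℝ (Z x) (Y x) := by
    simp [inner_smul_right, mvfderiv_fun_mul hf (mdifferentiableAt_inner hY hZ),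
      real_inner_comm (Y x), mul_comm]
  simp only [← koszul_add_koszul_swap] at hderiv
  linear_combination hderiv - koszul_smul_mid hf hX hZ hY

theorem tensorialAt_koszul_left (hY : MDiffAt (T% Y) x) (hZ : MDiffAt (T% Z) x) :
    TensorialAt I E (fun X ↦ koszul X Y Z x) x where
  smul hf hX := koszul_smul_left hf hX hY hZ
  add hX hX' := koszul_add_left hX hX' hY hZ

theorem tensorialAt_koszul_right (hX : MDiffAt (T% X) x) (hY : MDiffAt (T% Y) x) :
    TensorialAt I E (fun Z ↦ koszul X Y Z x) x where
  smul hf hZ := koszul_smul_right hf hX hY hZ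
  add hZ hZ' := koszul_add_right hX hY hZ hZ'

end Tensorial

variable [FiniteDimensional ℝ E]

/-- The bilinear form `(v, w) ↦ ⟪∇_v Y, w⟫` on the tangent space given by the Koszul formula. -/
def koszulForm (hY : MDiffAt (T% Y) x) : TangentSpace I x →L[ℝ] TangentSpace I x →L[ℝ] ℝ :=
  haveI := FiniteDimensional.complete ℝ E
  TensorialAt.mkHom₂ (fun X Z ↦ koszul X Y Z x) x (fun _ hZ ↦ tensorialAt_koszul_left hY hZ)
    (fun _ hX ↦ tensorialAt_koszul_right hX hY)

theorem koszulForm_apply (hX : MDiffAt (T% X) x) (hY : MDiffAt (T% Y) x)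
    (hZ : MDiffAt (T% Z) x) : koszulForm hY (X x) (Z x) = koszul X Y Z x :=
  TensorialAt.mkHom₂_apply _ _ hX hZ

open scoped Classical in
/-- The Levi-Civita derivative `∇Y`, with the junk value `0` where `Y` is not differentiable. -/
def leviCivitaFun (Y : ∀ x : M, TangentSpace I x) (x : M) :
    TangentSpace I x →L[ℝ] TangentSpace I x :=
  if hY : MDiffAt (T% Y) x then rieszMap (koszulForm hY) else 0

theorem inner_leviCivitaFun (hX : MDiffAt (T% X) x) (hY : MDiffAt (T% Y) x)
    (hZ : MDiffAt (T% Z) x) : inner ℝ (leviCivitaFun Y x (X x)) (Z x) = koszul X Y Z x := by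
  rw [leviCivitaFun, dif_pos hY, inner_rieszMap, koszulForm_apply hX hY hZ]

variable (I M) in
/-- The Levi-Civita connection of a Riemannian manifold. -/
def leviCivita : CovariantDerivative I E (fun x : M ↦ TangentSpace I x) where
  toFun := leviCivitaFun
  isCovariantDerivativeOnUniv :=
    haveI := FiniteDimensional.complete ℝ E
    { add := fun {Y Y' x} hY hY' _ ↦ by
        refine hom_eq_of_fields fun X hX ↦ eq_of_inner_fields fun Z hZ ↦ ?_
        rw [inner_leviCivitaFun hX (mdifferentiableAt_add_section hY hY') hZ,
          koszul_add_mid hX hY hY' hZ, add_apply, inner_add_left,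
          inner_leviCivitaFun hX hY hZ, inner_leviCivitaFun hX hY' hZ]
      leibniz := fun {Y f x} hY hf _ ↦ by
        refine hom_eq_of_fields fun X hX ↦ eq_of_inner_fields fun Z hZ ↦ ?_
        rw [inner_leviCivitaFun hX (hf.smul_section hY) hZ,
          koszul_smul_mid hf hX hY hZ, add_apply, inner_add_left]
        simp [inner_smul_left, inner_leviCivitaFun hX hY hZ] }

theorem inner_leviCivita (hX : MDiffAt (T% X) x) (hY : MDiffAt (T% Y) x) (hZ : MDiffAt (T% Z) x) :
    inner ℝ (leviCivita I M Y x (X x)) (Z x) = koszul X Y Z x :=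
  inner_leviCivitaFun hX hY hZ

theorem isMetricCompatible_leviCivita :
    CovariantDerivative.IsMetricCompatible (V := fun x : M ↦ TangentSpace I x)
      (leviCivita I M) := by
  rw [CovariantDerivative.isMetricCompatible_iff]
  intro x X Y Z hX hY hZ
  beta_reduce
  rw [inner_leviCivita hX hY hZ, real_inner_comm, inner_leviCivita hX hZ hY,
    koszul_add_koszul_swap]

theorem torsion_leviCivita : (leviCivita I M).torsion = 0 := by
  rw [CovariantDerivative.torsion_eq_zero_iff]
  intro X Y x hX hY
  refine eq_of_inner_fields fun Z hZ ↦ ?_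
  rw [inner_sub_left, inner_leviCivita hX hY hZ, inner_leviCivita hY hX hZ,
    koszul_sub_koszul_swap]

theorem contMDiffAt_koszul (hX : CMDiffAt ∞ (T% X) x) (hY : CMDiffAt ∞ (T% Y) x)
    (hZ : CMDiffAt ∞ (T% Z) x) : CMDiffAt ∞ (koszul X Y Z) x := by
  have := FiniteDimensional.complete ℝ E
  have : IsManifold I (minSmoothness ℝ 2) M := by
    rw [minSmoothness_of_isRCLikeNormedField]
    infer_instance
  have : IsManifold I (((⊤ : ℕ∞) : ℕ∞ω) + 1) M := inferInstanceAs (IsManifold I ∞ M)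
  have contMDiffAt_bracket {V W : ∀ x : M, TangentSpace I x} (hV : CMDiffAt ∞ (T% V) x)
      (hW : CMDiffAt ∞ (T% W) x) : CMDiffAt ∞ (T% (mlieBracket I V W)) x :=
    ContMDiffAt.mlieBracket_vectorField (n := ⊤) (m := ⊤) hV hW (by simp)
  exact contMDiffAt_const.mul ((((((contMDiffAt_mvfderiv (contMDiffAt_inner hY hZ) hX).add
    (contMDiffAt_mvfderiv (contMDiffAt_inner hX hZ) hY)).sub
    (contMDiffAt_mvfderiv (contMDiffAt_inner hX hY) hZ)).add
    (contMDiffAt_inner (contMDiffAt_bracket hX hY) hZ)).sub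
    (contMDiffAt_inner (contMDiffAt_bracket hX hZ) hY)).sub
    (contMDiffAt_inner (contMDiffAt_bracket hY hZ) hX))

theorem contMDiffCovariantDerivative_leviCivita :
    (leviCivita I M).ContMDiffCovariantDerivative ∞ where
  contMDiff :=
    { contMDiff := fun {Y} hY x _ ↦ by
        have hY (y) : CMDiffAt ∞ (T% Y) y := (hY.contMDiffAt Filter.univ_mem).of_le (by simp)
        let b := Module.finBasis ℝ E
        let e := trivializationAt E (fun x : M ↦ TangentSpace I x) x
        have hx : x ∈ e.baseSet := FiberBundle.mem_baseSet_trivializationAt E _ x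
        have frame_smooth {y} (hy : y ∈ e.baseSet) (i) : CMDiffAt ∞ (T% (e.localFrame b i)) y :=
          contMDiffAt_localFrame_of_mem ∞ e b i hy
        refine ContMDiffAt.contMDiffWithinAt (contMDiffAt_hom_of_localFrame b fun i ↦
          contMDiffAt_of_inner_localFrame (V := fun x : M ↦ TangentSpace I x) b fun j ↦ ?_)
        refine (contMDiffAt_koszul (frame_smooth hx i) (hY x)
          (frame_smooth hx j)).congr_of_eventuallyEq ?_
        filter_upwards [e.open_baseSet.mem_nhds hx] with y hy
        exact inner_leviCivita ((frame_smooth hy i).mdifferentiableAt (by simp))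
          ((hY y).mdifferentiableAt (by simp)) ((frame_smooth hy j).mdifferentiableAt (by simp)) }

end LeviCivita

/-! ### Coordinate vector fields -/

section Coordinates

open VectorField

variable {n : ℕ} {M : Type*} [TopologicalSpace M] [ChartedSpace (EuclideanSpace ℝ (Fin n)) M]
  {e : OpenPartialHomeomorph M (EuclideanSpace ℝ (Fin n))} {x : M}

theorem isInvertible_mfderiv_of_mem_maximalAtlas (he : e ∈ IsManifold.maximalAtlas (𝓡 n) ∞ M)
    (hx : x ∈ e.source) : (mfderiv (𝓡 n) (𝓡 n) e x).IsInvertible := by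
  have he : e.MDifferentiable (𝓡 n) (𝓡 n) :=
    ⟨(contMDiffOn_of_mem_maximalAtlas he).mdifferentiableOn (by simp),
      (contMDiffOn_symm_of_mem_maximalAtlas he).mdifferentiableOn (by simp)⟩
  exact ⟨he.mfderiv hx, rfl⟩

theorem mfderiv_coordField (he : e ∈ IsManifold.maximalAtlas (𝓡 n) ∞ M) (hx : x ∈ e.source)
    (i : Fin n) : mfderiv (𝓡 n) (𝓡 n) e x (coordField e i x) =
      (EuclideanSpace.single i (1 : ℝ) : EuclideanSpace ℝ (Fin n)) :=
  (isInvertible_mfderiv_of_mem_maximalAtlas he hx).self_apply_inverse _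

theorem contMDiffAt_coordinate (he : e ∈ IsManifold.maximalAtlas (𝓡 n) ∞ M) (hx : x ∈ e.source)
    (i : Fin n) : ContMDiffAt (𝓡 n) 𝓘(ℝ, ℝ) ∞ (fun y ↦ e y i) x :=
  (EuclideanSpace.proj i : EuclideanSpace ℝ (Fin n) →L[ℝ] ℝ).contMDiff.contMDiffAt.comp x
    (contMDiffAt_of_mem_maximalAtlas he hx)

theorem coord_eq_mvfderiv (he : e ∈ IsManifold.maximalAtlas (𝓡 n) ∞ M) (hx : x ∈ e.source)
    (v : TangentSpace (𝓡 n) x) (i : Fin n) : coord e v i = mvfderiv (𝓡 n) (fun y ↦ e y i) x v := by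
  have chain_rule := congr($(mfderiv_comp (I := 𝓡 n) (I' := 𝓡 n) (I'' := 𝓘(ℝ, ℝ)) x
    (g := (EuclideanSpace.proj i : EuclideanSpace ℝ (Fin n) →L[ℝ] ℝ))
    (EuclideanSpace.proj i : EuclideanSpace ℝ (Fin n) →L[ℝ] ℝ).mdifferentiableAt
    ((contMDiffAt_of_mem_maximalAtlas he hx).mdifferentiableAt (by simp))) v)
  rw [ContinuousLinearMap.mfderiv_eq] at chain_rule
  exact chain_rule.symm

theorem coord_coordField (he : e ∈ IsManifold.maximalAtlas (𝓡 n) ∞ M) (hx : x ∈ e.source)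
    (i j : Fin n) : coord e (coordField e i x) j = if i = j then 1 else 0 := by
  rw [coord, mfderiv_coordField he hx]
  simp [eq_comm]

/-- The coordinate `y^i` of the local coordinates `e` as a linear form on the tangent space. -/
def coordForm (e : OpenPartialHomeomorph M (EuclideanSpace ℝ (Fin n))) (x : M) (i : Fin n) :
    TangentSpace (𝓡 n) x →L[ℝ] ℝ :=
  (EuclideanSpace.proj i : EuclideanSpace ℝ (Fin n) →L[ℝ] ℝ).comp (mfderiv (𝓡 n) (𝓡 n) e x)

theorem coordForm_apply (v : TangentSpace (𝓡 n) x) (i : Fin n) :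
    coordForm e x i v = coord e v i := rfl

theorem coord_neg (v : TangentSpace (𝓡 n) x) (i : Fin n) : coord e (-v) i = -coord e v i :=
  map_neg (coordForm e x i) v

theorem coord_sub (v w : TangentSpace (𝓡 n) x) (i : Fin n) :
    coord e (v - w) i = coord e v i - coord e w i :=
  map_sub (coordForm e x i) v w

theorem coord_smul (a : ℝ) (v : TangentSpace (𝓡 n) x) (i : Fin n) :
    coord e (a • v) i = a * coord e v i :=
  map_smul (coordForm e x i) a v

theorem coord_sum_smul_coordField (he : e ∈ IsManifold.maximalAtlas (𝓡 n) ∞ M)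
    (hx : x ∈ e.source) (a : Fin n → ℝ) (k : Fin n) :
    coord e (∑ i, a i • coordField e i x) k = a k := by
  simp only [← coordForm_apply, map_sum, map_smul]
  simp [coordForm_apply, coord_coordField he hx]

theorem coord_ext (he : e ∈ IsManifold.maximalAtlas (𝓡 n) ∞ M) (hx : x ∈ e.source)
    {v w : TangentSpace (𝓡 n) x} (h : ∀ i, coord e v i = coord e w i) : v = w :=
  (isInvertible_mfderiv_of_mem_maximalAtlas he hx).injective (PiLp.ext h)

theorem sum_coord_smul (he : e ∈ IsManifold.maximalAtlas (𝓡 n) ∞ M) (hx : x ∈ e.source)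
    (v : TangentSpace (𝓡 n) x) : ∑ i, coord e v i • coordField e i x = v :=
  coord_ext he hx fun k ↦ coord_sum_smul_coordField he hx _ k

theorem sum_coord_mul (he : e ∈ IsManifold.maximalAtlas (𝓡 n) ∞ M) (hx : x ∈ e.source)
    (l : TangentSpace (𝓡 n) x →L[ℝ] ℝ) (v : TangentSpace (𝓡 n) x) :
    ∑ i, coord e v i * l (coordField e i x) = l v := by
  conv_rhs => rw [← sum_coord_smul he hx v]
  simp only [map_sum, map_smul, smul_eq_mul]

theorem partialDeriv_eq (he : e ∈ IsManifold.maximalAtlas (𝓡 n) ∞ M) (hx : x ∈ e.source)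
    (i : Fin n) {f : M → ℝ} (hf : MDifferentiableAt (𝓡 n) 𝓘(ℝ, ℝ) f x) :
    partialDeriv e i f x = mvfderiv (𝓡 n) f x (coordField e i x) := by
  have hsymm : MDifferentiableAt (𝓡 n) (𝓡 n) e.symm (e x) :=
    (contMDiffAt_symm_of_mem_maximalAtlas he (e.map_source hx)).mdifferentiableAt (by simp)
  have hfe : MDifferentiableAt (𝓡 n) 𝓘(ℝ, ℝ) (f ∘ e.symm) (e x) :=
    MDifferentiableAt.comp (e x) (by rwa [e.left_inv hx]) hsymm
  have hlocal : f =ᶠ[𝓝 x] (f ∘ e.symm) ∘ e := by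
    filter_upwards [e.open_source.mem_nhds hx] with y hy
    rw [Function.comp_apply, Function.comp_apply, e.left_inv hy]
  have chain_rule : mvfderiv (𝓡 n) f x (coordField e i x) =
      fderiv ℝ (f ∘ e.symm) (e x) (mfderiv (𝓡 n) (𝓡 n) e x (coordField e i x)) := by
    rw [← mfderiv_eq_fderiv]
    exact congr($((hlocal.mfderiv_eq).trans (mfderiv_comp x hfe
      ((contMDiffAt_of_mem_maximalAtlas he hx).mdifferentiableAt (by simp))))
        (coordField e i x))
  exact (chain_rule.trans (congrArg _ (mfderiv_coordField he hx i))).symm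

variable [IsManifold (𝓡 n) ∞ M]

theorem contMDiffAt_coordField (he : e ∈ IsManifold.maximalAtlas (𝓡 n) ∞ M) (hx : x ∈ e.source)
    (i : Fin n) : ContMDiffAt (𝓡 n) (𝓡 n).tangent ∞ (T% (coordField e i)) x :=
  ContMDiffAt.mpullback_vectorField_preimage (n := ∞)
    (contMDiffAt_vectorSpace_iff_contDiffAt.2 contDiffAt_const)
    (contMDiffAt_of_mem_maximalAtlas he hx) (isInvertible_mfderiv_of_mem_maximalAtlas he hx)
    (by simp)

theorem mdifferentiableAt_coordField (he : e ∈ IsManifold.maximalAtlas (𝓡 n) ∞ M)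
    (hx : x ∈ e.source) (i : Fin n) :
    MDifferentiableAt (𝓡 n) (𝓡 n).tangent (T% (coordField e i)) x :=
  (contMDiffAt_coordField he hx i).mdifferentiableAt (by simp)

theorem mlieBracket_const {E : Type*} [NormedAddCommGroup E] [NormedSpace ℝ E] (v w : E) :
    mlieBracket 𝓘(ℝ, E) (fun _ : E ↦ v) (fun _ ↦ w) = 0 := by
  refine (mlieBracketWithin_univ (I := 𝓘(ℝ, E))).symm.trans
    (mlieBracketWithin_eq_lieBracketWithin.trans ?_)
  funext z
  simp only [lieBracketWithin, fderivWithin_fun_const, Pi.zero_apply, zero_apply, sub_zero]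
  rfl

theorem mlieBracket_coordField (he : e ∈ IsManifold.maximalAtlas (𝓡 n) ∞ M) (hx : x ∈ e.source)
    (i j : Fin n) : mlieBracket (𝓡 n) (coordField e i) (coordField e j) x = 0 := by
  have : IsManifold (𝓡 n) (minSmoothness ℝ 2) M := by
    rw [minSmoothness_of_isRCLikeNormedField]
    infer_instance
  have hconst (v : EuclideanSpace ℝ (Fin n)) : MDifferentiableAt (𝓡 n) (𝓡 n).tangent
      (fun z ↦ (⟨z, v⟩ : TangentBundle (𝓡 n) (EuclideanSpace ℝ (Fin n)))) (e x) :=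
    (contMDiffAt_vectorSpace_iff_contDiffAt.2 (contDiffAt_const (n := ∞))).mdifferentiableAt
      (by simp)
  have hpullback := mpullback_mlieBracket (hconst (EuclideanSpace.single i 1))
    (hconst (EuclideanSpace.single j 1)) (contMDiffAt_of_mem_maximalAtlas he hx)
    (by simpa using ENat.LEInfty.out)
  rw [mlieBracket_const, mpullback_zero] at hpullback
  exact hpullback.symm

end Coordinates

/-! ### Derivatives along curves and parallel vector fields -/

section Curves

variable {E : Type*} [NormedAddCommGroup E] [NormedSpace ℝ E] {H : Type*} [TopologicalSpace H]
  {I : ModelWithCorners ℝ E H} {M : Type*} [TopologicalSpace M] [ChartedSpace H M]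
  {c : ℝ → M} {s : Set ℝ} {t : ℝ}

variable (I) in
/-- The velocity within `s` of the curve `c`. -/
def velocityWithin (c : ℝ → M) (s : Set ℝ) (t : ℝ) : TangentSpace I (c t) :=
  mfderivWithin 𝓘(ℝ, ℝ) I c s t (1 : ℝ)

theorem hasDerivWithinAt_comp_curve (hc : MDifferentiableWithinAt 𝓘(ℝ, ℝ) I c s t)
    {f : M → ℝ} (hf : MDiffAt f (c t)) :
    HasDerivWithinAt (fun r ↦ f (c r)) (mvfderiv I f (c t) (velocityWithin I c s t)) s t := by
  have hcomp : HasFDerivWithinAt (f ∘ c) ((mvfderiv I f (c t)).comp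
      (mfderivWithin 𝓘(ℝ, ℝ) I c s t : ℝ →L[ℝ] TangentSpace I (c t))) s t :=
    hasMFDerivWithinAt_iff_hasFDerivWithinAt.1
      (hf.hasMFDerivAt.comp_hasMFDerivWithinAt t hc.hasMFDerivWithinAt)
  exact hcomp.hasDerivWithinAt

end Curves

theorem eq_of_hasDerivWithinAt_zero {f : ℝ → ℝ}
    (hf : ∀ t ∈ Icc (0 : ℝ) 1, HasDerivWithinAt f 0 (Icc 0 1) t) {t : ℝ} (ht : t ∈ Icc (0 : ℝ) 1) :
    f t = f 0 :=
  constant_of_derivWithin_zero (fun t ht ↦ (hf t ht).differentiableWithinAt)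
    (fun t ht ↦ (hf t (Ico_subset_Icc_self ht)).derivWithin
      (uniqueDiffOn_Icc zero_lt_one t (Ico_subset_Icc_self ht))) t ht

theorem isLocallyConstant_of_mvfderiv_eq_zero {E : Type*} [NormedAddCommGroup E] [NormedSpace ℝ E]
    {M : Type*} [TopologicalSpace M] [ChartedSpace E M] [IsManifold 𝓘(ℝ, E) 1 M] {f : M → ℝ}
    (hf : ∀ x, MDiffAt f x) (hzero : ∀ x, mvfderiv 𝓘(ℝ, E) f x = 0) : IsLocallyConstant f := by
  rw [IsLocallyConstant.iff_eventually_eq]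
  intro x
  set e := chartAt E x
  have hx : x ∈ e.source := mem_chart_source E x
  have hfderiv {z : E} (hz : z ∈ e.target) : HasFDerivAt (f ∘ e.symm) (0 : E →L[ℝ] ℝ) z := by
    have hcomp := (hf (e.symm z)).hasMFDerivAt.comp z
      (mdifferentiableAt_atlas_symm (I := 𝓘(ℝ, E)) (chart_mem_atlas E x) hz).hasMFDerivAt
    have hvanish (v : TangentSpace 𝓘(ℝ, E) (e.symm z)) :
        mfderiv 𝓘(ℝ, E) 𝓘(ℝ, ℝ) f (e.symm z) v = (0 : ℝ) := congr($(hzero (e.symm z)) v)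
    exact (hasMFDerivAt_iff_hasFDerivAt.1 hcomp).congr_fderiv
      (ContinuousLinearMap.ext fun v ↦ hvanish (mfderiv 𝓘(ℝ, E) 𝓘(ℝ, E) e.symm z v))
  obtain ⟨ρ, hρ, hball⟩ := Metric.isOpen_iff.1 e.open_target (e x) (e.map_source hx)
  filter_upwards [e.continuousAt hx (Metric.ball_mem_nhds _ hρ), e.open_source.mem_nhds hx]
    with y hy hys
  have heq := Metric.isOpen_ball.is_const_of_fderiv_eq_zero (convex_ball (e x) ρ).isPreconnected
    (fun z hz ↦ (hfderiv (hball hz)).differentiableAt.differentiableWithinAt)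
    (fun z hz ↦ (hfderiv (hball hz)).fderiv) hy (Metric.mem_ball_self hρ)
  simpa only [Function.comp_apply, e.left_inv hys, e.left_inv hx] using heq

section Metric

variable {E : Type*} [NormedAddCommGroup E] [NormedSpace ℝ E]
  {H : Type*} [TopologicalSpace H] {I : ModelWithCorners ℝ E H}
  {M : Type*} [TopologicalSpace M] [ChartedSpace H M]
  {F : Type*} [NormedAddCommGroup F] [NormedSpace ℝ F] [FiniteDimensional ℝ F]
  {V : M → Type*} [TopologicalSpace (TotalSpace F V)] [∀ x, NormedAddCommGroup (V x)]
  [∀ x, InnerProductSpace ℝ (V x)] [FiberBundle F V] [VectorBundle ℝ F V]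
  [ContMDiffVectorBundle 1 F V I] [IsContMDiffRiemannianBundle I 1 F V]
  (nabla : CovariantDerivative I F V) {x : M}

theorem mvfderiv_inner [FiniteDimensional ℝ E] [IsManifold I 1 M] {Y Z : ∀ x, V x}
    (hY : MDiffAt (T% Y) x) (hZ : MDiffAt (T% Z) x) (u : TangentSpace I x) :
    mvfderiv I (fun y ↦ inner ℝ (Y y) (Z y)) x u =
      nabla.derivMetricTensor x (Y x) (Z x) u + inner ℝ (nabla Y x u) (Z x)
        + inner ℝ (Y x) (nabla Z x u) := by
  have hmetric := nabla.derivMetricTensor_apply x hY hZ (X := FiberBundle.extend E u)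
  simp only [FiberBundle.extend_apply_self] at hmetric
  linear_combination -hmetric

theorem derivMetricTensor_symm (v w : V x) (u : TangentSpace I x) :
    nabla.derivMetricTensor x v w u = nabla.derivMetricTensor x w v u := by
  simp only [CovariantDerivative.derivMetricTensor_apply_eq_extend, real_inner_comm]
  ring

end Metric

section Parallel

variable {n : ℕ} {M : Type*} [TopologicalSpace M] [ChartedSpace (EuclideanSpace ℝ (Fin n)) M]
  {e : OpenPartialHomeomorph M (EuclideanSpace ℝ (Fin n))} {c : ℝ → M} {s : Set ℝ} {t : ℝ}

theorem coord_velocityWithin (he : e ∈ IsManifold.maximalAtlas (𝓡 n) ∞ M) (hce : c t ∈ e.source)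
    (hs : UniqueDiffWithinAt ℝ s t) (hc : MDifferentiableWithinAt 𝓘(ℝ, ℝ) (𝓡 n) c s t)
    (i : Fin n) :
    coord e (velocityWithin (𝓡 n) c s t) i = derivWithin (fun r ↦ (e (c r)) i) s t := by
  rw [coord_eq_mvfderiv he hce]
  exact ((hasDerivWithinAt_comp_curve hc
    ((contMDiffAt_coordinate he hce i).mdifferentiableAt (by simp))).derivWithin hs).symm

variable [IsManifold (𝓡 n) ∞ M] {nabla : LinConn n M} {X : ∀ t : ℝ, TangentSpace (𝓡 n) (c t)}

/-- The equation of parallel vector fields along `c`, at the parameter `t`, in the coordinates `e`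
and with derivatives taken within `s`. -/
def IsParallelAt (nabla : LinConn n M) (e : OpenPartialHomeomorph M (EuclideanSpace ℝ (Fin n)))
    (c : ℝ → M) (X : ∀ t : ℝ, TangentSpace (𝓡 n) (c t)) (s : Set ℝ) (t : ℝ) : Prop :=
  ∀ k : Fin n, HasDerivWithinAt (fun r ↦ coord e (X r) k)
    (-∑ i : Fin n, ∑ j : Fin n, derivWithin (fun r ↦ (e (c r)) i) s t *
      coord e (X t) j * connParam e nabla i j k (c t)) s t

theorem IsParallelAt.neg (hX : IsParallelAt nabla e c X s t) :
    IsParallelAt nabla e c (fun r ↦ -X r) s t := fun k ↦ by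
  simpa only [coord_neg, mul_neg, neg_mul, Finset.sum_neg_distrib] using (hX k).fun_neg

theorem IsParallelAt.hasDerivWithinAt_coord (hX : IsParallelAt nabla e c X s t)
    (he : e ∈ IsManifold.maximalAtlas (𝓡 n) ∞ M) (hce : c t ∈ e.source)
    (hs : UniqueDiffWithinAt ℝ s t) (hc : MDifferentiableWithinAt 𝓘(ℝ, ℝ) (𝓡 n) c s t)
    (k : Fin n) :
    HasDerivWithinAt (fun r ↦ coord e (X r) k) (-∑ j, coord e (X t) j *
      coord e (nabla (coordField e j) (c t) (velocityWithin (𝓡 n) c s t)) k) s t := by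
  refine (hX k).congr_deriv (congrArg _ ?_)
  rw [Finset.sum_comm]
  refine Finset.sum_congr rfl fun j _ ↦ ?_
  have hexpand := sum_coord_mul he hce ((coordForm e (c t) k).comp
    (nabla (coordField e j) (c t))) (velocityWithin (𝓡 n) c s t)
  simp only [coord_velocityWithin he hce hs hc] at hexpand
  refine Eq.trans ?_ (congrArg (coord e (X t) j * ·) hexpand)
  rw [Finset.mul_sum]
  exact Finset.sum_congr rfl fun i _ ↦ by rw [mul_assoc, mul_left_comm]; rfl

/-- The product rule `(l X)' = (∇l) X` for a covector field `l` along the curve whose components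
`φ` have covariant derivatives `φ'`. -/
theorem IsParallelAt.hasDerivWithinAt_sum_coord_mul (hX : IsParallelAt nabla e c X s t)
    (he : e ∈ IsManifold.maximalAtlas (𝓡 n) ∞ M) (hce : c t ∈ e.source)
    (hs : UniqueDiffWithinAt ℝ s t) (hc : MDifferentiableWithinAt 𝓘(ℝ, ℝ) (𝓡 n) c s t)
    {l : TangentSpace (𝓡 n) (c t) →L[ℝ] ℝ} {φ : Fin n → ℝ → ℝ} {φ' : Fin n → ℝ}
    (hl : ∀ j, φ j t = l (coordField e j (c t)))
    (hφ : ∀ j, HasDerivWithinAt (φ j)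
      (φ' j + l (nabla (coordField e j) (c t) (velocityWithin (𝓡 n) c s t))) s t) :
    HasDerivWithinAt (fun r ↦ ∑ j, coord e (X r) j * φ j r) (∑ j, coord e (X t) j * φ' j) s t := by
  set u := velocityWithin (𝓡 n) c s t
  refine (HasDerivWithinAt.fun_sum fun j _ ↦
    (hX.hasDerivWithinAt_coord he hce hs hc j).mul (hφ j)).congr_deriv ?_
  have hcancel : ∑ k, (∑ j, coord e (X t) j * coord e (nabla (coordField e j) (c t) u) k) * φ k t =
      ∑ j, coord e (X t) j * l (nabla (coordField e j) (c t) u) := by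
    simp only [hl, ← sum_coord_mul he hce l (nabla (coordField e _) (c t) u), Finset.mul_sum,
      Finset.sum_mul, mul_assoc]
    exact Finset.sum_comm
  rw [Finset.sum_add_distrib]
  simp only [mul_add, neg_mul, Finset.sum_neg_distrib, Finset.sum_add_distrib]
  linear_combination -hcancel

variable [RiemannianBundle (fun x : M ↦ TangentSpace (𝓡 n) x)]
  [IsContMDiffRiemannianBundle (𝓡 n) ∞ (EuclideanSpace ℝ (Fin n))
    (fun x : M ↦ TangentSpace (𝓡 n) x)]

theorem IsParallelAt.hasDerivWithinAt_inner (hX : IsParallelAt nabla e c X s t)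
    (he : e ∈ IsManifold.maximalAtlas (𝓡 n) ∞ M) (hce : c t ∈ e.source) (hts : t ∈ s)
    (hs : UniqueDiffWithinAt ℝ s t) (hc : MDifferentiableWithinAt 𝓘(ℝ, ℝ) (𝓡 n) c s t)
    {V : ∀ x : M, TangentSpace (𝓡 n) x} (hV : MDifferentiableAt (𝓡 n) (𝓡 n).tangent (T% V) (c t)) :
    HasDerivWithinAt (fun r ↦ inner ℝ (V (c r)) (X r))
      (nabla.derivMetricTensor (c t) (V (c t)) (X t) (velocityWithin (𝓡 n) c s t)
        + inner ℝ (nabla V (c t) (velocityWithin (𝓡 n) c s t)) (X t)) s t := by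
  set u := velocityWithin (𝓡 n) c s t
  have hcomponents := hX.hasDerivWithinAt_sum_coord_mul he hce hs hc
    (l := innerSL ℝ (V (c t))) (fun _ ↦ rfl) fun j ↦
    (hasDerivWithinAt_comp_curve hc (mdifferentiableAt_inner hV
      (mdifferentiableAt_coordField he hce j))).congr_deriv (mvfderiv_inner nabla hV
        (mdifferentiableAt_coordField he hce j) u)
  refine (hcomponents.congr_of_eventuallyEq_of_mem ?_ hts).congr_deriv ?_
  · filter_upwards [hc.continuousWithinAt (e.open_source.mem_nhds hce)] with r hr
    exact (sum_coord_mul he hr (innerSL ℝ (V (c r))) (X r)).symm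
  · exact sum_coord_mul he hce ((nabla.derivMetricTensor (c t) (V (c t))).flip u
      + innerSL ℝ (nabla V (c t) u)) (X t)

theorem IsParallelAt.hasDerivWithinAt_inner_self (hX : IsParallelAt nabla e c X s t)
    (he : e ∈ IsManifold.maximalAtlas (𝓡 n) ∞ M) (hce : c t ∈ e.source) (hts : t ∈ s)
    (hs : UniqueDiffWithinAt ℝ s t) (hc : MDifferentiableWithinAt 𝓘(ℝ, ℝ) (𝓡 n) c s t) :
    HasDerivWithinAt (fun r ↦ inner ℝ (X r) (X r))
      (nabla.derivMetricTensor (c t) (X t) (X t) (velocityWithin (𝓡 n) c s t)) s t := by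
  set u := velocityWithin (𝓡 n) c s t
  have hcomponents := hX.hasDerivWithinAt_sum_coord_mul he hce hs hc
    (l := innerSL ℝ (X t)) (fun _ ↦ real_inner_comm _ _) fun j ↦
    (hX.hasDerivWithinAt_inner he hce hts hs hc
      (mdifferentiableAt_coordField he hce j)).congr_deriv
        (congrArg _ (real_inner_comm _ _))
  refine (hcomponents.congr_of_eventuallyEq_of_mem ?_ hts).congr_deriv ?_
  · filter_upwards [hc.continuousWithinAt (e.open_source.mem_nhds hce)] with r hr
    simpa only [innerSL_apply_apply, real_inner_comm (X r)] using
      (sum_coord_mul he hr (innerSL ℝ (X r)) (X r)).symm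
  · have hexpand := sum_coord_mul he hce ((nabla.derivMetricTensor (c t) (X t)).flip u) (X t)
    refine (Finset.sum_congr rfl fun j _ ↦ ?_).trans hexpand
    rw [derivMetricTensor_symm, ContinuousLinearMap.flip_apply]

end Parallel

/-! ### Metric connections with parallel dual vector field are compatible -/

section Compatible

variable {n : ℕ} {M : Type*} [TopologicalSpace M] [ChartedSpace (EuclideanSpace ℝ (Fin n)) M]
  [IsManifold (𝓡 n) ∞ M] [RiemannianBundle (fun x : M ↦ TangentSpace (𝓡 n) x)]
  {β : ∀ x : M, TangentSpace (𝓡 n) x →L[ℝ] ℝ} {F : TangentBundle (𝓡 n) M → ℝ}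

theorem inner_sharp (β : ∀ x : M, TangentSpace (𝓡 n) x →L[ℝ] ℝ) (x : M)
    (v : TangentSpace (𝓡 n) x) : inner ℝ (sharp β x) v = β x v :=
  haveI := completeSpace_tangent (n := n) x
  InnerProductSpace.toDual_symm_apply

theorem IsRandersMetric.apply_eq (hF : IsRandersMetric F β) (x : M) (v : TangentSpace (𝓡 n) x) :
    F ⟨x, v⟩ = √(inner ℝ v v) + inner ℝ (sharp β x) v := by
  rw [hF.eq_add, inner_sharp, norm_eq_sqrt_real_inner]

variable [IsContMDiffRiemannianBundle (𝓡 n) ∞ (EuclideanSpace ℝ (Fin n))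
    (fun x : M ↦ TangentSpace (𝓡 n) x)]

theorem contMDiffAt_sharp {x : M} (hβ : ContMDiffAt (𝓡 n)
      ((𝓡 n).prod 𝓘(ℝ, EuclideanSpace ℝ (Fin n) →L[ℝ] ℝ)) ∞
      (fun x ↦ TotalSpace.mk' (EuclideanSpace ℝ (Fin n) →L[ℝ] ℝ)
        (E := fun x : M ↦ TangentSpace (𝓡 n) x →L[ℝ] ℝ) x (β x)) x) :
    ContMDiffAt (𝓡 n) (𝓡 n).tangent ∞ (T% (sharp β)) x := by
  set b := (EuclideanSpace.basisFun (Fin n) ℝ).toBasis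
  refine contMDiffAt_of_inner_localFrame (V := fun x : M ↦ TangentSpace (𝓡 n) x) b fun i ↦ ?_
  simp only [inner_sharp]
  have hframe := contMDiffAt_localFrame_of_mem (V := fun x : M ↦ TangentSpace (𝓡 n) x)
    (I := 𝓡 n) ∞ (trivializationAt (EuclideanSpace ℝ (Fin n)) (TangentSpace (𝓡 n)) x) b i
    (FiberBundle.mem_baseSet_trivializationAt _ _ x)
  have hsection : ContMDiffAt (𝓡 n) ((𝓡 n).prod 𝓘(ℝ)) ∞ (fun y ↦ TotalSpace.mk' ℝ
      (E := Bundle.Trivial M ℝ) y (β y ((trivializationAt (EuclideanSpace ℝ (Fin n))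
        (TangentSpace (𝓡 n)) x).localFrame b i y))) x :=
    ContMDiffAt.clm_bundle_apply (F₁ := EuclideanSpace ℝ (Fin n)) hβ hframe
  exact (contMDiffAt_totalSpace.1 hsection).2

theorem IsRandersMetric.mdifferentiableAt_sharp (hF : IsRandersMetric F β) (x : M) :
    MDifferentiableAt (𝓡 n) (𝓡 n).tangent (T% (sharp β)) x :=
  (contMDiffAt_sharp (hF.smooth_form x)).mdifferentiableAt (by simp)

theorem IsRandersMetric.isCompatible (hF : IsRandersMetric F β) {nabla : LinConn n M}
    (hs : nabla.ContMDiffCovariantDerivative ∞) (hmetric : nabla.IsMetricCompatible)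
    (hsharp : ∀ x, nabla (sharp β) x = 0) : IsCompatible nabla F where
  smooth := hs
  parallel c X hc hX t ht := by
    have hmetric_apply (x : M) : nabla.derivMetricTensor x = 0 := congr_fun hmetric x
    have hself : inner ℝ (X t) (X t) = inner ℝ (X 0) (X 0) := by
      refine eq_of_hasDerivWithinAt_zero (f := fun r ↦ inner ℝ (X r) (X r)) (fun r hr ↦ ?_) ht
      obtain ⟨e, he, hce, hXr : IsParallelAt nabla e c X (Icc 0 1) r⟩ := hX r hr
      simpa [hmetric_apply] using hXr.hasDerivWithinAt_inner_self he hce hr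
        (uniqueDiffOn_Icc zero_lt_one r hr) ((hc r hr).mdifferentiableWithinAt (by simp))
    have hinner : inner ℝ (sharp β (c t)) (X t) = inner ℝ (sharp β (c 0)) (X 0) := by
      refine eq_of_hasDerivWithinAt_zero (f := fun r ↦ inner ℝ (sharp β (c r)) (X r))
        (fun r hr ↦ ?_) ht
      obtain ⟨e, he, hce, hXr : IsParallelAt nabla e c X (Icc 0 1) r⟩ := hX r hr
      simpa [hmetric_apply, hsharp] using hXr.hasDerivWithinAt_inner he hce hr
        (uniqueDiffOn_Icc zero_lt_one r hr) ((hc r hr).mdifferentiableWithinAt (by simp))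
        (hF.mdifferentiableAt_sharp (c r))
    rw [hF.apply_eq, hF.apply_eq, hself, hinner]

end Compatible

/-! ### Existence of parallel vector fields -/

theorem exists_eventually_hasDerivAt {E : Type*} [NormedAddCommGroup E] [NormedSpace ℝ E]
    [CompleteSpace E] {f : ℝ × E → E} {v : E} (hf : ContDiffAt ℝ 1 f (0, v)) :
    ∃ ξ : ℝ → E, ξ 0 = v ∧ ∀ᶠ t in 𝓝 0, HasDerivAt ξ (f (t, ξ t)) t := by
  have hautonomous : ContDiffAt ℝ 1 (fun z : ℝ × E ↦ ((1 : ℝ), f z)) (0, v) :=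
    contDiffAt_const.prodMk hf
  obtain ⟨α, hα0, ε, hε, hα⟩ :=
    hautonomous.exists_forall_mem_closedBall_exists_eq_forall_mem_Ioo_hasDerivAt₀ 0
  simp only [zero_sub, zero_add] at hα
  have htime {t : ℝ} (ht : t ∈ Ioo (-ε) ε) : (α t).1 = t := by
    have hderiv {r : ℝ} (hr : r ∈ Ioo (-ε) ε) : HasDerivAt (fun r ↦ (α r).1 - r) 0 r :=
      (((ContinuousLinearMap.fst ℝ ℝ E).hasFDerivAt.comp_hasDerivAt r (hα r hr)).sub
        (hasDerivAt_id r)).congr_deriv (sub_self _)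
    have hconst := isOpen_Ioo.is_const_of_deriv_eq_zero isPreconnected_Ioo
      (fun r hr ↦ (hderiv hr).differentiableAt.differentiableWithinAt)
      (fun r hr ↦ (hderiv hr).deriv) ht (show (0 : ℝ) ∈ Ioo (-ε) ε from ⟨by linarith, hε⟩)
    simpa [hα0, sub_eq_zero] using hconst
  refine ⟨fun t ↦ (α t).2, by simp [hα0], ?_⟩
  filter_upwards [Ioo_mem_nhds (neg_lt_zero.2 hε) hε] with t ht
  have hpair : α t = (t, (α t).2) := Prod.ext (htime ht) rfl
  exact ((ContinuousLinearMap.snd ℝ ℝ E).hasFDerivAt.comp_hasDerivAt t (hα t ht)).congr_deriv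
    (congrArg f hpair)

theorem exists_pos_forall_mul_of_eventually {P : ℝ → Prop} (hP : ∀ᶠ t in 𝓝 0, P t) :
    ∃ δ > 0, ∀ r ∈ Icc (0 : ℝ) 1, P (δ * r) := by
  obtain ⟨ε, hε, hball⟩ := Metric.eventually_nhds_iff.1 hP
  refine ⟨ε / 2, half_pos hε, fun r hr ↦ hball ?_⟩
  rw [dist_zero_right, Real.norm_of_nonneg (mul_nonneg (half_pos hε).le hr.1)]
  nlinarith [hr.2]

theorem velocityWithin_comp_mul {E : Type*} [NormedAddCommGroup E] [NormedSpace ℝ E] {H : Type*}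
    [TopologicalSpace H] {I : ModelWithCorners ℝ E H} {M : Type*} [TopologicalSpace M]
    [ChartedSpace H M] {c : ℝ → M} {s : Set ℝ} {δ t : ℝ} (hs : UniqueDiffWithinAt ℝ s t)
    (hc : MDifferentiableAt 𝓘(ℝ, ℝ) I c (δ * t)) :
    velocityWithin I (fun r ↦ c (δ * r)) s t = δ • velocityWithin I c univ (δ * t) := by
  have hscale : HasMFDerivWithinAt 𝓘(ℝ, ℝ) 𝓘(ℝ, ℝ) (δ * ·) s t
      (ContinuousLinearMap.toSpanSingleton ℝ (δ * 1)) :=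
    ((hasDerivAt_id t).const_mul δ).hasDerivWithinAt.hasFDerivWithinAt.hasMFDerivWithinAt
  have hcomp := (hc.hasMFDerivAt.comp_hasMFDerivWithinAt t hscale).mfderivWithin
    hs.uniqueMDiffWithinAt
  rw [velocityWithin, velocityWithin, mfderivWithin_univ]
  refine (congr($hcomp (1 : ℝ))).trans ?_
  refine Eq.trans ?_ (map_smul (mfderiv 𝓘(ℝ, ℝ) I c (δ * t)) δ (1 : ℝ))
  exact congrArg (mfderiv 𝓘(ℝ, ℝ) I c (δ * t)) ((one_smul ℝ (δ * 1)).trans rfl)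

section Existence

variable {n : ℕ} {M : Type*} [TopologicalSpace M] [ChartedSpace (EuclideanSpace ℝ (Fin n)) M]
  {e : OpenPartialHomeomorph M (EuclideanSpace ℝ (Fin n))}

theorem tangentBundle_ext (he : e ∈ IsManifold.maximalAtlas (𝓡 n) ∞ M)
    {v w : TangentBundle (𝓡 n) M} (hv : v.proj ∈ e.source) (hproj : v.proj = w.proj)
    (hcoord : ∀ i, coord e v.2 i = coord e w.2 i) : v = w := by
  obtain ⟨x, v⟩ := v
  obtain ⟨y, w⟩ := w
  obtain rfl : x = y := hproj
  exact congrArg (TotalSpace.mk x) (coord_ext he hv hcoord)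

variable [IsManifold (𝓡 n) ∞ M] {nabla : LinConn n M} {c : ℝ → M} {s : Set ℝ} {t : ℝ}

theorem contMDiffAt_connParam [T2Space M] (hs : nabla.ContMDiffCovariantDerivative ∞)
    (he : e ∈ IsManifold.maximalAtlas (𝓡 n) ∞ M) {x : M} (hx : x ∈ e.source) (i j k : Fin n) :
    ContMDiffAt (𝓡 n) 𝓘(ℝ, ℝ) ∞ (connParam e nabla i j k) x := by
  have hfield : ContMDiffAt (𝓡 n) (𝓡 n).tangent ∞
      (T% (fun y ↦ nabla (coordField e j) y (coordField e i y))) x :=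
    ContMDiffAt.clm_bundle_apply (contMDiffAt_covariantDerivative hs
      ((e.open_source.eventually_mem hx).mono fun y hy ↦ contMDiffAt_coordField he hy j))
      (contMDiffAt_coordField he hx i)
  refine (contMDiffAt_mvfderiv (contMDiffAt_coordinate he hx k) hfield).congr_of_eventuallyEq ?_
  filter_upwards [e.open_source.mem_nhds hx] with y hy
  exact coord_eq_mvfderiv he hy _ k

theorem IsParallelAt.comp_mul {X : ∀ t : ℝ, TangentSpace (𝓡 n) (c t)} {δ : ℝ}
    (hX : IsParallelAt nabla e c X univ (δ * t))
    (he : e ∈ IsManifold.maximalAtlas (𝓡 n) ∞ M) (hce : c (δ * t) ∈ e.source)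
    (hs : UniqueDiffWithinAt ℝ s t) (hc : MDifferentiableAt 𝓘(ℝ, ℝ) (𝓡 n) c (δ * t)) :
    IsParallelAt nabla e (fun r ↦ c (δ * r)) (fun r ↦ X (δ * r)) s t := fun k ↦ by
  have hscale : HasDerivWithinAt (δ * ·) δ s t := by
    simpa using ((hasDerivAt_id t).const_mul δ).hasDerivWithinAt
  have hvelocity (i : Fin n) : derivWithin (fun r ↦ e (c (δ * r)) i) s t =
      δ * derivWithin (fun r ↦ e (c r) i) univ (δ * t) := by
    have hcδ : MDifferentiableWithinAt 𝓘(ℝ, ℝ) (𝓡 n) (fun r ↦ c (δ * r)) s t :=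
      hc.comp_mdifferentiableWithinAt t hscale.differentiableWithinAt.mdifferentiableWithinAt
    rw [← coord_velocityWithin (c := fun r ↦ c (δ * r)) (t := t) he hce hs hcδ,
      velocityWithin_comp_mul hs hc, coord_smul,
      coord_velocityWithin he hce uniqueDiffWithinAt_univ hc.mdifferentiableWithinAt]
  refine ((hasDerivWithinAt_univ.1 (hX k)).comp_hasDerivWithinAt t hscale).congr_deriv ?_
  simp only [hvelocity, neg_mul, Finset.sum_mul]
  refine congrArg _ (Finset.sum_congr rfl fun i _ ↦ Finset.sum_congr rfl fun j _ ↦ ?_)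
  ring

theorem exists_eventually_isParallelAt [T2Space M] (hs : nabla.ContMDiffCovariantDerivative ∞)
    (he : e ∈ IsManifold.maximalAtlas (𝓡 n) ∞ M) (hce : c 0 ∈ e.source)
    (hc : ContMDiffAt 𝓘(ℝ, ℝ) (𝓡 n) ∞ c 0) (v : TangentSpace (𝓡 n) (c 0)) :
    ∃ X : ∀ t : ℝ, TangentSpace (𝓡 n) (c t), X 0 = v ∧
      ∀ᶠ t in 𝓝 0, IsParallelAt nabla e c X univ t := by
  let f : ℝ × EuclideanSpace ℝ (Fin n) → EuclideanSpace ℝ (Fin n) := fun z ↦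
    WithLp.toLp 2 fun k ↦ -∑ i, ∑ j, derivWithin (fun r ↦ (e (c r)) i) univ z.1 * z.2 j *
      connParam e nabla i j k (c z.1)
  have hvelocity (i : Fin n) : ContDiffAt ℝ 1 (derivWithin (fun r ↦ (e (c r)) i) univ) 0 := by
    rw [derivWithin_univ]
    exact ((((contMDiffAt_coordinate he hce i).comp 0 hc).contDiffAt.of_le
      ENat.LEInfty.out).fderiv_right (m := 1) (n := 2) (by norm_num)).clm_apply contDiffAt_const
  have hparam (i j k : Fin n) : ContDiffAt ℝ 1 (fun t ↦ connParam e nabla i j k (c t)) 0 :=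
    (((contMDiffAt_connParam hs he hce i j k).comp 0 hc).contDiffAt).of_le ENat.LEInfty.out
  have hf : ContDiffAt ℝ 1 f (0, WithLp.toLp 2 (coord e v)) :=
    (contDiffAt_euclidean (𝕜 := ℝ)).2 fun k ↦ (ContDiffAt.sum fun i _ ↦ ContDiffAt.sum fun j _ ↦
      (((hvelocity i).comp (0, WithLp.toLp 2 (coord e v)) contDiffAt_fst).mul
        ((EuclideanSpace.proj j : EuclideanSpace ℝ (Fin n) →L[ℝ] ℝ).contDiff.contDiffAt.comp _
          contDiffAt_snd)).mul
        ((hparam i j k).comp (0, WithLp.toLp 2 (coord e v)) contDiffAt_fst)).neg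
  obtain ⟨ξ, hξ0, hξ⟩ := exists_eventually_hasDerivAt hf
  have hsource : ∀ᶠ t in 𝓝 0, c t ∈ e.source :=
    hc.continuousAt.eventually_mem (e.open_source.mem_nhds hce)
  refine ⟨fun t ↦ ∑ j, ξ t j • coordField e j (c t), ?_, ?_⟩
  · simp only [hξ0]
    exact sum_coord_smul he hce v
  filter_upwards [hξ, hsource.eventually_nhds] with t hξt ht k
  have hcomponent := (EuclideanSpace.proj k : EuclideanSpace ℝ (Fin n) →L[ℝ] ℝ).hasFDerivAt
    |>.comp_hasDerivAt t hξt
  simp only [coord_sum_smul_coordField he ht.self_of_nhds]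
  refine (hcomponent.congr_of_eventuallyEq ?_).hasDerivWithinAt
  filter_upwards [ht] with r hr
  exact coord_sum_smul_coordField he hr _ k

theorem exists_curve_velocityWithin_eq {x : M} (w : TangentSpace (𝓡 n) x) :
    ∃ c : ℝ → M, (∀ᶠ t in 𝓝 0, ContMDiffAt 𝓘(ℝ, ℝ) (𝓡 n) ∞ c t) ∧
      (⟨c 0, velocityWithin (𝓡 n) c univ 0⟩ : TangentBundle (𝓡 n) M) = ⟨x, w⟩ := by
  set e := chartAt (EuclideanSpace ℝ (Fin n)) x
  have he : e ∈ IsManifold.maximalAtlas (𝓡 n) ∞ M := IsManifold.chart_mem_maximalAtlas x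
  have hx : x ∈ e.source := mem_chart_source _ x
  let γ : ℝ → EuclideanSpace ℝ (Fin n) := fun t ↦ e x + t • WithLp.toLp 2 (coord e w)
  have hγ : ContDiff ℝ ∞ γ := by fun_prop
  have htarget : ∀ᶠ t in 𝓝 0, γ t ∈ e.target := hγ.continuous.continuousAt.eventually_mem
    (e.open_target.mem_nhds (by simpa [γ] using e.map_source hx))
  have hc : ∀ᶠ t in 𝓝 0, ContMDiffAt 𝓘(ℝ, ℝ) (𝓡 n) ∞ (fun t ↦ e.symm (γ t)) t :=
    htarget.mono fun t ht ↦
      (contMDiffAt_symm_of_mem_maximalAtlas he ht).comp t hγ.contDiffAt.contMDiffAt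
  have hc0 : e.symm (γ 0) = x := by simp [γ, e.left_inv hx]
  refine ⟨fun t ↦ e.symm (γ t), hc, tangentBundle_ext he
    (e.map_target htarget.self_of_nhds) hc0 fun i ↦ ?_⟩
  rw [coord_velocityWithin he (by rwa [hc0]) uniqueDiffWithinAt_univ
    (hc.self_of_nhds.mdifferentiableAt (by simp)).mdifferentiableWithinAt, derivWithin_univ]
  have hline : HasDerivAt (fun t ↦ γ t i) (coord e w i) 0 := by
    simpa [γ] using ((hasDerivAt_id (0 : ℝ)).mul_const (coord e w i)).const_add (e x i)
  refine (hline.congr_of_eventuallyEq ?_).deriv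
  filter_upwards [htarget] with t ht
  rw [e.right_inv ht]

/-- The rescaling factor `δ` makes the short curve and field provided by local existence of
solutions live on `[0, 1]`. -/
theorem exists_isParallelAlong [T2Space M] (hs : nabla.ContMDiffCovariantDerivative ∞) {x : M}
    (v w : TangentSpace (𝓡 n) x) :
    ∃ (c : ℝ → M) (X : ∀ t : ℝ, TangentSpace (𝓡 n) (c t)), ∃ δ > (0 : ℝ),
      ContMDiffOn 𝓘(ℝ, ℝ) (𝓡 n) ∞ c (Icc 0 1) ∧ IsParallelAlong nabla c X ∧
      (⟨c 0, X 0⟩ : TangentBundle (𝓡 n) M) = ⟨x, v⟩ ∧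
      (⟨c 0, velocityWithin (𝓡 n) c (Icc 0 1) 0⟩ : TangentBundle (𝓡 n) M) = ⟨x, δ • w⟩ := by
  obtain ⟨c, hc, hvelocity⟩ := exists_curve_velocityWithin_eq w
  obtain rfl : c 0 = x := congrArg TotalSpace.proj hvelocity
  obtain rfl : velocityWithin (𝓡 n) c univ 0 = w := TotalSpace.mk_injective (c 0) hvelocity
  set e := chartAt (EuclideanSpace ℝ (Fin n)) (c 0)
  have he : e ∈ IsManifold.maximalAtlas (𝓡 n) ∞ M := IsManifold.chart_mem_maximalAtlas (c 0)
  have hsource : ∀ᶠ t in 𝓝 0, c t ∈ e.source := hc.self_of_nhds.continuousAt.eventually_mem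
    (e.open_source.mem_nhds (mem_chart_source _ (c 0)))
  obtain ⟨X, rfl, hX⟩ := exists_eventually_isParallelAt hs he hsource.self_of_nhds
    hc.self_of_nhds v
  obtain ⟨δ, hδ, hpos⟩ := exists_pos_forall_mul_of_eventually (hsource.and (hc.and hX))
  refine ⟨fun r ↦ c (δ * r), fun r ↦ X (δ * r), δ, hδ, fun r hr ↦ ?_, fun r hr ↦ ?_, ?_, ?_⟩
  · exact ((hpos r hr).2.1.comp r (contDiff_const.mul contDiff_id).contMDiff.contMDiffAt)
      |>.contMDiffWithinAt
  · exact ⟨e, he, (hpos r hr).1, (hpos r hr).2.2.comp_mul he (hpos r hr).1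
      (uniqueDiffOn_Icc zero_lt_one r hr) ((hpos r hr).2.1.mdifferentiableAt (by simp))⟩
  · exact congrArg (fun r ↦ (⟨c r, X r⟩ : TangentBundle (𝓡 n) M)) (mul_zero δ)
  · have h0 : (0 : ℝ) ∈ Icc (0 : ℝ) 1 := left_mem_Icc.2 zero_le_one
    rw [velocityWithin_comp_mul (uniqueDiffOn_Icc zero_lt_one 0 h0)
      ((hpos 0 h0).2.1.mdifferentiableAt (by simp))]
    exact congrArg (fun r ↦ (⟨c r, δ • velocityWithin (𝓡 n) c univ r⟩ : TangentBundle (𝓡 n) M))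
      (mul_zero δ)

end Existence

/-! ### Compatible connections are metric and parallelize the dual vector field -/

section Characterization

variable {n : ℕ} {M : Type*} [TopologicalSpace M] [ChartedSpace (EuclideanSpace ℝ (Fin n)) M]
  [IsManifold (𝓡 n) ∞ M] {nabla : LinConn n M}

theorem IsParallelAlong.neg {c : ℝ → M} {X : ∀ t : ℝ, TangentSpace (𝓡 n) (c t)}
    (hX : IsParallelAlong nabla c X) : IsParallelAlong nabla c fun t ↦ -X t := fun t ht ↦ by
  obtain ⟨e, he, hce, hXt⟩ := hX t ht
  exact ⟨e, he, hce, IsParallelAt.neg hXt⟩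

variable [RiemannianBundle (fun x : M ↦ TangentSpace (𝓡 n) x)]
  {β : ∀ x : M, TangentSpace (𝓡 n) x →L[ℝ] ℝ} {F : TangentBundle (𝓡 n) M → ℝ}

/-- The even and odd parts of `F` are recovered from `X` and `-X`, which are both parallel. -/
theorem IsCompatible.inner_eq (h : IsCompatible nabla F) (hF : IsRandersMetric F β) {c : ℝ → M}
    {X : ∀ t : ℝ, TangentSpace (𝓡 n) (c t)} (hc : ContMDiffOn 𝓘(ℝ, ℝ) (𝓡 n) ∞ c (Icc 0 1))
    (hX : IsParallelAlong nabla c X) {t : ℝ} (ht : t ∈ Icc (0 : ℝ) 1) :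
    inner ℝ (X t) (X t) = inner ℝ (X 0) (X 0) ∧
      inner ℝ (sharp β (c t)) (X t) = inner ℝ (sharp β (c 0)) (X 0) := by
  have hpos := h.parallel c X hc hX t ht
  have hneg := h.parallel c (fun t ↦ -X t) hc hX.neg t ht
  simp only [hF.apply_eq, inner_neg_left, inner_neg_right, neg_neg] at hpos hneg
  exact ⟨(Real.sqrt_inj real_inner_self_nonneg real_inner_self_nonneg).1 (by linarith),
    by linarith⟩

variable [IsContMDiffRiemannianBundle (𝓡 n) ∞ (EuclideanSpace ℝ (Fin n))
    (fun x : M ↦ TangentSpace (𝓡 n) x)]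

theorem IsCompatible.derivMetricTensor_eq_zero [T2Space M] (h : IsCompatible nabla F)
    (hF : IsRandersMetric F β) {x : M} (v u : TangentSpace (𝓡 n) x) :
    nabla.derivMetricTensor x v v u = 0 ∧
      nabla.derivMetricTensor x (sharp β x) v u + inner ℝ (nabla (sharp β) x u) v = 0 := by
  obtain ⟨c, X, δ, hδ, hc, hX, hX0, hvelocity⟩ := exists_isParallelAlong h.smooth v u
  obtain rfl : c 0 = x := congrArg TotalSpace.proj hX0
  obtain rfl : X 0 = v := TotalSpace.mk_injective (c 0) hX0
  replace hvelocity := TotalSpace.mk_injective (c 0) hvelocity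
  have h0 : (0 : ℝ) ∈ Icc (0 : ℝ) 1 := left_mem_Icc.2 zero_le_one
  have hunique := uniqueDiffOn_Icc (zero_lt_one (α := ℝ)) 0 h0
  have hc0 := (hc 0 h0).mdifferentiableWithinAt (by simp)
  obtain ⟨e, he, hce, hXe : IsParallelAt nabla e c X (Icc 0 1) 0⟩ := hX 0 h0
  have hself := hunique.eq_deriv _ (hXe.hasDerivWithinAt_inner_self he hce h0 hunique hc0)
    ((hasDerivWithinAt_const 0 _ _).congr (fun t ht ↦ (h.inner_eq hF hc hX ht).1) rfl)
  have hsharp := hunique.eq_deriv _ (hXe.hasDerivWithinAt_inner he hce h0 hunique hc0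
    (hF.mdifferentiableAt_sharp (c 0)))
    ((hasDerivWithinAt_const 0 _ _).congr (fun t ht ↦ (h.inner_eq hF hc hX ht).2) rfl)
  simpa only [hvelocity, map_smul, smul_eq_mul, real_inner_smul_left, ← mul_add, mul_eq_zero,
    hδ.ne', false_or] using And.intro hself hsharp

theorem IsCompatible.isMetricCompatible [T2Space M] (h : IsCompatible nabla F)
    (hF : IsRandersMetric F β) : nabla.IsMetricCompatible := by
  rw [CovariantDerivative.isMetricCompatible_iff]
  intro x X Y Z _ hY hZ
  have hpolar := (h.derivMetricTensor_eq_zero hF (Y x + Z x) (X x)).1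
  simp only [ContinuousLinearMap.map_add, add_apply,
    (h.derivMetricTensor_eq_zero hF (Y x) (X x)).1,
    (h.derivMetricTensor_eq_zero hF (Z x) (X x)).1,
    derivMetricTensor_symm nabla (Z x) (Y x) (X x)] at hpolar
  rw [mvfderiv_inner nabla hY hZ]
  linarith

theorem IsCompatible.apply_sharp [T2Space M] (h : IsCompatible nabla F)
    (hF : IsRandersMetric F β) (x : M) : nabla (sharp β) x = 0 := by
  ext1 u
  refine ext_inner_right ℝ fun v ↦ ?_
  have hsharp := (h.derivMetricTensor_eq_zero hF v u).2
  rw [congr_fun (h.isMetricCompatible hF) x] at hsharp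
  simpa using hsharp

theorem IsCompatible.norm_sharp_eq [T2Space M] [PreconnectedSpace M] (h : IsCompatible nabla F)
    (hF : IsRandersMetric F β) (x y : M) : ‖sharp β x‖ = ‖sharp β y‖ := by
  have hsq : IsLocallyConstant fun x ↦ inner ℝ (sharp β x) (sharp β x) := by
    have hsharp := hF.mdifferentiableAt_sharp
    refine isLocallyConstant_of_mvfderiv_eq_zero
      (fun x ↦ mdifferentiableAt_inner (hsharp x) (hsharp x)) fun x ↦ ?_
    ext u
    rw [mvfderiv_inner nabla (hsharp x) (hsharp x), congr_fun (h.isMetricCompatible hF) x,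
      h.apply_sharp hF]
    simp
  rw [norm_eq_sqrt_real_inner, norm_eq_sqrt_real_inner, hsq.apply_eq_of_preconnectedSpace x y]

theorem IsRandersMetric.isRiemannianNorm_of_sharp_eq_zero (hF : IsRandersMetric F β)
    (h : ∀ x, sharp β x = 0) : IsRiemannianNorm F := by
  obtain ⟨g, hg, hinner⟩ := IsContMDiffRiemannianBundle.exists_contMDiff (IB := 𝓡 n) (n := ∞)
    (F := EuclideanSpace ℝ (Fin n)) (E := fun x : M ↦ TangentSpace (𝓡 n) x)
  refine ⟨⟨g, fun x v w ↦ ?_, fun x v hv ↦ ?_, fun x ↦ ?_, hg⟩, fun x v ↦ ?_⟩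
  · rw [← hinner, ← hinner, real_inner_comm]
  · rw [← hinner]
    exact real_inner_self_pos.2 hv
  · simp only [← hinner]
    exact RiemannianBundle.g.isVonNBounded x
  · rw [hF.apply_eq, h, inner_zero_left, add_zero, hinner]

theorem IsCompatible.exists_norm_sharp_eq [T2Space M] [ConnectedSpace M]
    (h : IsCompatible nabla F) (hF : IsRandersMetric F β) (hnR : ¬ IsRiemannianNorm F) :
    ∃ r > 0, ∀ x, ‖sharp β x‖ = r := by
  obtain ⟨x₀⟩ := ConnectedSpace.toNonempty (α := M)
  refine ⟨‖sharp β x₀‖, norm_pos_iff.2 fun hzero ↦ hnR ?_, fun x ↦ h.norm_sharp_eq hF x x₀⟩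
  exact hF.isRiemannianNorm_of_sharp_eq_zero fun x ↦ norm_eq_zero.1
    ((h.norm_sharp_eq hF x x₀).trans (norm_eq_zero.2 hzero))

end Characterization

/-! ### Linear algebra of torsion and difference tensors -/

section Algebra

variable {W : Type*} [NormedAddCommGroup W] [InnerProductSpace ℝ W]
  {V : W} {T A : W →L[ℝ] W →L[ℝ] W}

/-- The linear conditions which characterize the torsion `T` of the extremal compatible connection
at a point, `V` being the value of the dual vector field there: `T` vanishes on `Vᗮ`, and `T V` is
symmetric on `Vᗮ`. -/
structure IsExtremalTensor (V : W) (T : W →L[ℝ] W →L[ℝ] W) : Prop where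
  inner_eq_zero : ∀ x y z, inner ℝ V x = 0 → inner ℝ V y = 0 → inner ℝ V z = 0 →
    inner ℝ (T x y) z = 0
  inner_symm : ∀ y z, inner ℝ V y = 0 → inner ℝ V z = 0 →
    inner ℝ (T V y) z = inner ℝ (T V z) y

/-- The properties of the difference `A` at a point of two metric connections with parallel `V`.
As in Mathlib's `CovariantDerivative.difference`, the vector of differentiation comes second:
`A y x` stands for `∇'_x y - ∇_x y`. -/
structure IsDifferenceTensor (V : W) (A : W →L[ℝ] W →L[ℝ] W) : Prop where
  skew : ∀ x y z, inner ℝ (A y x) z = -inner ℝ (A z x) y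
  apply_eq_zero : A V = 0

theorem IsDifferenceTensor.inner_eq_zero (hA : IsDifferenceTensor V A) (x y : W) :
    inner ℝ V (A y x) = 0 := by
  rw [real_inner_comm, hA.skew, hA.apply_eq_zero, zero_apply, inner_zero_left, neg_zero]

theorem IsDifferenceTensor.eq_zero_of_symm (hA : IsDifferenceTensor V A)
    (hsymm : ∀ x y, A y x = A x y) : A = 0 := by
  refine ContinuousLinearMap.ext fun y ↦ ContinuousLinearMap.ext fun x ↦
    ext_inner_right ℝ fun z ↦ ?_
  have hcyclic : inner ℝ (A y x) z = -inner ℝ (A y x) z := calc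
    inner ℝ (A y x) z = -inner ℝ (A x z) y := by rw [hA.skew, hsymm]
    _ = inner ℝ (A z y) x := by rw [hA.skew, hsymm, neg_neg]
    _ = -inner ℝ (A y x) z := by rw [hA.skew, hsymm]
  rw [zero_apply, zero_apply, inner_zero_left]
  linarith

theorem inner_starProjection_orthogonal_singleton (V x : W) :
    inner ℝ V ((ℝ ∙ V)ᗮ.starProjection x) = 0 :=
  Submodule.mem_orthogonal_singleton_iff_inner_right.1 (Submodule.starProjection_apply_mem _ x)

theorem starProjection_orthogonal_singleton_of_inner_eq_zero {x : W} (hx : inner ℝ V x = 0) :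
    (ℝ ∙ V)ᗮ.starProjection x = x :=
  Submodule.starProjection_eq_self_iff.2 (Submodule.mem_orthogonal_singleton_iff_inner_right.2 hx)

theorem starProjection_orthogonal_singleton (V x : W) :
    (ℝ ∙ V)ᗮ.starProjection x = x - (inner ℝ V x / inner ℝ V V) • V := by
  rw [Submodule.starProjection_orthogonal_val, Submodule.starProjection_singleton,
    real_inner_self_eq_norm_sq]
  rfl

theorem IsExtremalTensor.inner_apply_difference (hT : IsExtremalTensor V T)
    (hA : IsDifferenceTensor V A) (x y : W) :
    inner ℝ (T x y) (A y x) =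
      (inner ℝ V x * inner ℝ (T V ((ℝ ∙ V)ᗮ.starProjection y)) (A y x) +
        inner ℝ V y * inner ℝ (T x V) (A y x)) / inner ℝ V V := by
  have hfront := hT.inner_eq_zero _ _ _ (inner_starProjection_orthogonal_singleton V x)
    (inner_starProjection_orthogonal_singleton V y) (hA.inner_eq_zero x y)
  have hy : T x y = T x ((ℝ ∙ V)ᗮ.starProjection y) + (inner ℝ V y / inner ℝ V V) • T x V := by
    rw [starProjection_orthogonal_singleton, map_sub, map_smul, sub_add_cancel]
  rw [starProjection_orthogonal_singleton V x, map_sub, map_smul, sub_apply, smul_apply,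
    inner_sub_left, real_inner_smul_left, sub_eq_zero] at hfront
  rw [hy, inner_add_left, real_inner_smul_left, hfront]
  ring

section OrthonormalBasis

variable {ι : Type*} [Fintype ι] (b : OrthonormalBasis ι ℝ W)

include b in
theorem sum_inner_mul_apply (l : W →L[ℝ] ℝ) (v : W) :
    ∑ i, inner ℝ v (b i) * l (b i) = l v := by
  conv_rhs => rw [← b.sum_repr' v, map_sum]
  simp only [map_smul, smul_eq_mul, real_inner_comm]

theorem sum_inner_eq_zero_of_symm_of_skew {S K : W → W}
    (hS : ∀ x y, inner ℝ (S x) y = inner ℝ (S y) x)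
    (hK : ∀ x y, inner ℝ (K x) y = -inner ℝ (K y) x) : ∑ j, inner ℝ (S (b j)) (K (b j)) = 0 := by
  refine self_eq_neg.1 ?_
  calc ∑ j, inner ℝ (S (b j)) (K (b j))
    _ = ∑ j, ∑ k, inner ℝ (S (b j)) (b k) * inner ℝ (b k) (K (b j)) := by
      simp only [b.sum_inner_mul_inner]
    _ = -∑ j, ∑ k, inner ℝ (S (b k)) (b j) * inner ℝ (b j) (K (b k)) := by
      simp only [← Finset.sum_neg_distrib]
      refine Finset.sum_congr rfl fun j _ ↦ Finset.sum_congr rfl fun k _ ↦ ?_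
      rw [hS (b j), real_inner_comm (K (b j)), hK (b j), real_inner_comm (K (b k)), mul_neg]
    _ = -∑ k, ∑ j, inner ℝ (S (b k)) (b j) * inner ℝ (b j) (K (b k)) := by
      rw [Finset.sum_comm]
    _ = -∑ j, inner ℝ (S (b j)) (K (b j)) := by
      simp only [b.sum_inner_mul_inner]

theorem IsExtremalTensor.sum_inner_starProjection_eq_zero (hT : IsExtremalTensor V T)
    (hA : IsDifferenceTensor V A) :
    ∑ j, inner ℝ (T V ((ℝ ∙ V)ᗮ.starProjection (b j))) (A (b j) V) = 0 := by
  set P := (ℝ ∙ V)ᗮ.starProjection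
  have hsymm : ∀ x y, inner ℝ (P (T V (P x))) y = inner ℝ (P (T V (P y))) x := fun x y ↦ by
    rw [Submodule.inner_starProjection_left_eq_right, Submodule.inner_starProjection_left_eq_right]
    exact hT.inner_symm _ _ (inner_starProjection_orthogonal_singleton V x)
      (inner_starProjection_orthogonal_singleton V y)
  refine Eq.trans (Finset.sum_congr rfl fun j _ ↦ ?_)
    (sum_inner_eq_zero_of_symm_of_skew b hsymm (K := fun y ↦ A y V) (hA.skew V))
  rw [Submodule.inner_starProjection_left_eq_right,
    starProjection_orthogonal_singleton_of_inner_eq_zero (hA.inner_eq_zero V (b j))]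

theorem IsExtremalTensor.sum_inner_eq_zero (hT : IsExtremalTensor V T)
    (hA : IsDifferenceTensor V A) : ∑ i, ∑ j, inner ℝ (T (b i) (b j)) (A (b j) (b i)) = 0 := by
  have hleft : ∑ i, ∑ j, inner ℝ V (b i) *
      inner ℝ (T V ((ℝ ∙ V)ᗮ.starProjection (b j))) (A (b j) (b i)) = 0 := by
    rw [Finset.sum_comm, ← hT.sum_inner_starProjection_eq_zero b hA]
    exact Finset.sum_congr rfl fun j _ ↦ sum_inner_mul_apply b
      ((innerSL ℝ (T V ((ℝ ∙ V)ᗮ.starProjection (b j)))).comp (A (b j))) V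
  have hright : ∀ i, ∑ j, inner ℝ V (b j) * inner ℝ (T (b i) V) (A (b j) (b i)) = 0 := fun i ↦ by
    refine (sum_inner_mul_apply b ((innerSL ℝ (T (b i) V)).comp (A.flip (b i))) V).trans ?_
    simp [hA.apply_eq_zero]
  simp only [hT.inner_apply_difference hA, ← Finset.sum_div, Finset.sum_add_distrib, hleft, hright,
    add_zero, zero_div]

variable [LinearOrder ι] [LocallyFiniteOrderTop ι] [LocallyFiniteOrderBot ι]

theorem IsExtremalTensor.sum_Ioi_inner_eq_zero (hT : IsExtremalTensor V T)
    (hanti : ∀ x y, T x y = -T y x) (hA : IsDifferenceTensor V A) :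
    ∑ i, ∑ j ∈ Finset.Ioi i, inner ℝ (T (b i) (b j)) (A (b j) (b i) - A (b i) (b j)) = 0 := by
  have hdiag : ∀ i, inner ℝ (T (b i) (b i)) (A (b i) (b i)) = 0 := fun i ↦
    self_eq_neg.1 (by conv_lhs => rw [hanti, inner_neg_left])
  calc ∑ i, ∑ j ∈ Finset.Ioi i, inner ℝ (T (b i) (b j)) (A (b j) (b i) - A (b i) (b j))
    _ = ∑ i, ∑ j ∈ Finset.Ioi i, (inner ℝ (T (b i) (b j)) (A (b j) (b i)) +
        inner ℝ (T (b j) (b i)) (A (b i) (b j))) := by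
      refine Finset.sum_congr rfl fun i _ ↦ Finset.sum_congr rfl fun j _ ↦ ?_
      rw [hanti (b j), inner_neg_left, inner_sub_right, sub_eq_add_neg]
    _ = ∑ i, ∑ j ∈ {i}ᶜ, inner ℝ (T (b i) (b j)) (A (b j) (b i)) :=
      Finset.sum_sum_Ioi_add_eq_sum_sum_off_diag
        fun j i ↦ inner ℝ (T (b i) (b j)) (A (b j) (b i))
    _ = ∑ i, ∑ j, inner ℝ (T (b i) (b j)) (A (b j) (b i)) := by
      refine Finset.sum_congr rfl fun i _ ↦ ?_
      rw [Fintype.sum_eq_add_sum_compl i, hdiag, zero_add]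
    _ = 0 := hT.sum_inner_eq_zero b hA

theorem IsExtremalTensor.sum_Ioi_norm_sq_add (hT : IsExtremalTensor V T)
    (hanti : ∀ x y, T x y = -T y x) (hA : IsDifferenceTensor V A) :
    ∑ i, ∑ j ∈ Finset.Ioi i, ‖T (b i) (b j) + (A (b j) (b i) - A (b i) (b j))‖ ^ 2 =
      ∑ i, ∑ j ∈ Finset.Ioi i, ‖T (b i) (b j)‖ ^ 2 +
        ∑ i, ∑ j ∈ Finset.Ioi i, ‖A (b j) (b i) - A (b i) (b j)‖ ^ 2 := by
  simp only [norm_add_sq_real, Finset.sum_add_distrib, ← Finset.mul_sum,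
    hT.sum_Ioi_inner_eq_zero b hanti hA, mul_zero, add_zero]

omit [LocallyFiniteOrderBot ι] in
theorem IsDifferenceTensor.eq_zero_of_sum_Ioi_eq_zero (hA : IsDifferenceTensor V A)
    (h : ∑ i, ∑ j ∈ Finset.Ioi i, ‖A (b j) (b i) - A (b i) (b j)‖ ^ 2 = 0) : A = 0 := by
  have hlt : ∀ i j, i < j → A (b j) (b i) = A (b i) (b j) := fun i j hij ↦ by
    have hi := (Finset.sum_eq_zero_iff_of_nonneg (fun i _ ↦ by positivity)).1 h i
      (Finset.mem_univ i)
    have hj := (Finset.sum_eq_zero_iff_of_nonneg (fun j _ ↦ by positivity)).1 hi j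
      (Finset.mem_Ioi.2 hij)
    exact sub_eq_zero.1 (norm_eq_zero.1 (pow_eq_zero_iff two_ne_zero |>.1 hj))
  have hflip : A.toLinearMap₁₂ = A.toLinearMap₁₂.flip := by
    refine LinearMap.ext_basis b.toBasis b.toBasis fun i j ↦ ?_
    simp only [b.coe_toBasis, ContinuousLinearMap.toLinearMap₁₂_apply, LinearMap.flip_apply]
    rcases lt_trichotomy i j with hij | rfl | hij
    exacts [(hlt i j hij).symm, rfl, hlt j i hij]
  exact hA.eq_zero_of_symm fun x y ↦ congr($hflip y x)

end OrthonormalBasis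

variable [FiniteDimensional ℝ W]

/-- Twice the skew part of the compression of `S` to `Vᗮ`, extended by zero to the whole space. -/
def compressedSkewPart (V : W) (S : W →L[ℝ] W) : W →L[ℝ] W :=
  haveI := FiniteDimensional.complete ℝ W
  (ℝ ∙ V)ᗮ.starProjection ∘L (S - S.adjoint) ∘L (ℝ ∙ V)ᗮ.starProjection

theorem inner_compressedSkewPart (V : W) (S : W →L[ℝ] W) (y z : W) :
    inner ℝ (compressedSkewPart V S y) z =
      inner ℝ (S ((ℝ ∙ V)ᗮ.starProjection y)) ((ℝ ∙ V)ᗮ.starProjection z) -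
        inner ℝ (S ((ℝ ∙ V)ᗮ.starProjection z)) ((ℝ ∙ V)ᗮ.starProjection y) := by
  have := FiniteDimensional.complete ℝ W
  rw [compressedSkewPart, ContinuousLinearMap.comp_apply, ContinuousLinearMap.comp_apply,
    Submodule.inner_starProjection_left_eq_right, sub_apply, inner_sub_left,
    ContinuousLinearMap.adjoint_inner_left, real_inner_comm (S _)]

/-- The difference tensor of the extremal compatible connection and the Levi-Civita connection at a
point, where `V` is the value of the dual vector field and `S x` its covariant derivative along
`x`. The first two terms are the rotation which makes `V` parallel; the last one, which does not
affect `V`, makes the torsion satisfy `IsExtremalTensor.inner_symm`. -/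
def extremalDifference (V : W) (S : W →L[ℝ] W) : W →L[ℝ] W →L[ℝ] W :=
  LinearMap.toContinuousBilinearMap <| LinearMap.mk₂ ℝ
    (fun y x ↦ (inner ℝ V V)⁻¹ • (inner ℝ (S x) y • V - inner ℝ V y • S x -
      (inner ℝ V x / 2) • compressedSkewPart V S y))
    (fun y y' x ↦ by simp only [inner_add_right, map_add]; module)
    (fun a y x ↦ by simp only [real_inner_smul_right, map_smul]; module)
    (fun y x x' ↦ by simp only [inner_add_left, inner_add_right, map_add]; module)
    (fun a y x ↦ by simp only [real_inner_smul_left, real_inner_smul_right, map_smul]; module)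

theorem inner_extremalDifference (V : W) (S : W →L[ℝ] W) (y x z : W) :
    inner ℝ (extremalDifference V S y x) z =
      (inner ℝ V V)⁻¹ * (inner ℝ (S x) y * inner ℝ V z - inner ℝ V y * inner ℝ (S x) z -
        inner ℝ V x / 2 *
          (inner ℝ (S ((ℝ ∙ V)ᗮ.starProjection y)) ((ℝ ∙ V)ᗮ.starProjection z) -
            inner ℝ (S ((ℝ ∙ V)ᗮ.starProjection z)) ((ℝ ∙ V)ᗮ.starProjection y))) := by
  simp only [extremalDifference, LinearMap.toContinuousBilinearMap_apply, LinearMap.mk₂_apply,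
    inner_sub_left, real_inner_smul_left, inner_compressedSkewPart]

theorem inner_extremalDifference_skew (V : W) (S : W →L[ℝ] W) (y x z : W) :
    inner ℝ (extremalDifference V S y x) z = -inner ℝ (extremalDifference V S z x) y := by
  rw [inner_extremalDifference, inner_extremalDifference]
  ring

theorem extremalDifference_self (hV : V ≠ 0) {S : W →L[ℝ] W} (hS : ∀ x, inner ℝ (S x) V = 0)
    (x : W) : extremalDifference V S V x = -S x := by
  have hVV := (real_inner_self_pos.2 hV).ne'
  have hproj : (ℝ ∙ V)ᗮ.starProjection V = 0 := by
    rw [starProjection_orthogonal_singleton, div_self hVV, one_smul, sub_self]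
  refine ext_inner_right ℝ fun z ↦ ?_
  rw [inner_extremalDifference, inner_neg_left, hS, hproj, map_zero, inner_zero_left,
    inner_zero_right]
  field_simp
  ring

theorem isExtremalTensor_of_eq_extremalDifference (hV : V ≠ 0) {S : W →L[ℝ] W}
    (hS : ∀ x, inner ℝ (S x) V = 0)
    (hT : ∀ x y, T x y = extremalDifference V S y x - extremalDifference V S x y) :
    IsExtremalTensor V T where
  inner_eq_zero x y z hx hy hz := by
    rw [hT, inner_sub_left, inner_extremalDifference, inner_extremalDifference, hx, hy, hz]
    ring
  inner_symm y z hy hz := by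
    have hVV := (real_inner_self_pos.2 hV).ne'
    simp only [hT, inner_sub_left, extremalDifference_self hV hS, inner_extremalDifference,
      inner_neg_left, hy, hz, starProjection_orthogonal_singleton_of_inner_eq_zero]
    field_simp
    ring

end Algebra

/-! ### Differences of connections -/

section Difference

variable {E : Type*} [NormedAddCommGroup E] [NormedSpace ℝ E] [FiniteDimensional ℝ E]
  {H : Type*} [TopologicalSpace H] {I : ModelWithCorners ℝ E H}
  {M : Type*} [TopologicalSpace M] [ChartedSpace H M] [IsManifold I ∞ M]
  {nabla nabla' : CovariantDerivative I E (fun x : M ↦ TangentSpace I x)} {x : M}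

theorem difference_apply {Y : ∀ x : M, TangentSpace I x} (hY : MDiffAt (T% Y) x) :
    nabla'.difference nabla x (Y x) = nabla' Y x - nabla Y x :=
  IsCovariantDerivativeOn.difference_apply _ _ (mem_univ x) hY

theorem torsion_eq_add
    {A : TangentSpace I x →L[ℝ] TangentSpace I x →L[ℝ] TangentSpace I x}
    (hA : ∀ Y : ∀ x : M, TangentSpace I x, MDiffAt (T% Y) x → nabla' Y x = nabla Y x + A (Y x))
    (u v : TangentSpace I x) :
    nabla'.torsion x u v = nabla.torsion x u v + (A v u - A u v) := by
  rw [CovariantDerivative.torsion_apply_eq_extend, CovariantDerivative.torsion_apply_eq_extend,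
    hA _ (FiberBundle.mdifferentiableAt_extend I E u),
    hA _ (FiberBundle.mdifferentiableAt_extend I E v)]
  simp only [add_apply, FiberBundle.extend_apply_self]
  abel

theorem torsion_eq_add_difference
    (nabla nabla' : CovariantDerivative I E (fun x : M ↦ TangentSpace I x))
    (u v : TangentSpace I x) :
    nabla'.torsion x u v = nabla.torsion x u v +
      (nabla'.difference nabla x v u - nabla'.difference nabla x u v) :=
  torsion_eq_add (fun Y hY ↦ by rw [difference_apply hY, add_sub_cancel]) u v

variable [RiemannianBundle (fun x : M ↦ TangentSpace I x)]
  [IsContMDiffRiemannianBundle I ∞ E (fun x : M ↦ TangentSpace I x)]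

theorem inner_difference_skew
    (hmetric : CovariantDerivative.IsMetricCompatible (V := fun x : M ↦ TangentSpace I x) nabla)
    (hmetric' : CovariantDerivative.IsMetricCompatible (V := fun x : M ↦ TangentSpace I x) nabla')
    (u v w : TangentSpace I x) :
    inner ℝ (nabla'.difference nabla x v u) w = -inner ℝ (nabla'.difference nabla x w u) v := by
  have hv := FiberBundle.mdifferentiableAt_extend I E v
  have hw := FiberBundle.mdifferentiableAt_extend I E w
  have hinner := hmetric.mvfderiv_inner_eq (FiberBundle.extend E u) hv hw
  have hinner' := hmetric'.mvfderiv_inner_eq (FiberBundle.extend E u) hv hw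
  have hdiff := difference_apply (nabla := nabla) (nabla' := nabla') hv
  have hdiff' := difference_apply (nabla := nabla) (nabla' := nabla') hw
  simp only [FiberBundle.extend_apply_self] at hinner hinner' hdiff hdiff'
  rw [hdiff, hdiff', sub_apply, sub_apply, inner_sub_left, inner_sub_left,
    real_inner_comm v (nabla' _ _ _), real_inner_comm v (nabla _ _ _)]
  linarith

end Difference

/-! ### The extremal connection of a vector field -/

section ExtremalConnection

variable {E : Type*} [NormedAddCommGroup E] [NormedSpace ℝ E] [FiniteDimensional ℝ E]
  {H : Type*} [TopologicalSpace H] {I : ModelWithCorners ℝ E H}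
  {M : Type*} [TopologicalSpace M] [ChartedSpace H M] [IsManifold I ∞ M]
  [RiemannianBundle (fun x : M ↦ TangentSpace I x)]
  [IsContMDiffRiemannianBundle I ∞ E (fun x : M ↦ TangentSpace I x)]
  {V X Y Z : ∀ x : M, TangentSpace I x} {x : M} {r : ℝ}

/-- The metric connection with parallel `V` (for `V` nowhere zero of constant length) which is
closest to the Levi-Civita connection in the sense of its torsion. -/
def extremalConnection (V : ∀ x : M, TangentSpace I x) :
    CovariantDerivative I E (fun x : M ↦ TangentSpace I x) :=
  (leviCivita I M).addOneForm fun x ↦ extremalDifference (V x) (leviCivita I M V x)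

theorem extremalConnection_apply (V Y : ∀ x : M, TangentSpace I x) (x : M) :
    extremalConnection V Y x =
      leviCivita I M Y x + extremalDifference (V x) (leviCivita I M V x) (Y x) :=
  rfl

theorem isMetricCompatible_extremalConnection (V : ∀ x : M, TangentSpace I x) :
    CovariantDerivative.IsMetricCompatible (V := fun x : M ↦ TangentSpace I x)
      (extremalConnection V) := by
  rw [CovariantDerivative.isMetricCompatible_iff]
  intro x X Y Z _ hY hZ
  rw [isMetricCompatible_leviCivita.mvfderiv_inner_eq X hY hZ]
  simp only [extremalConnection_apply, add_apply, inner_add_left, inner_add_right]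
  rw [inner_extremalDifference_skew, real_inner_comm (Y x)]
  ring

theorem inner_leviCivita_self (hV : MDiffAt (T% V) x) (hr : ∀ x, ‖V x‖ = r)
    (u : TangentSpace I x) : inner ℝ (leviCivita I M V x u) (V x) = 0 := by
  have hderiv := isMetricCompatible_leviCivita.mvfderiv_inner_eq (FiberBundle.extend E u) hV hV
  simp only [real_inner_self_eq_norm_sq, hr, mvfderiv_const, zero_apply,
    FiberBundle.extend_apply_self, real_inner_comm (leviCivita I M V x u)] at hderiv
  linarith

theorem extremalConnection_self (hV : MDiffAt (T% V) x) (hr : ∀ x, ‖V x‖ = r) (hVx : V x ≠ 0) :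
    extremalConnection V V x = 0 := by
  refine ContinuousLinearMap.ext fun u ↦ ?_
  rw [extremalConnection_apply, add_apply,
    extremalDifference_self hVx (inner_leviCivita_self hV hr), add_neg_cancel, zero_apply]

theorem isExtremalTensor_extremalConnection (hV : MDiffAt (T% V) x) (hr : ∀ x, ‖V x‖ = r)
    (hVx : V x ≠ 0) : IsExtremalTensor (V x) ((extremalConnection V).torsion x) := by
  refine isExtremalTensor_of_eq_extremalDifference hVx (inner_leviCivita_self hV hr) fun u v ↦ ?_
  rw [torsion_eq_add (fun Y _ ↦ extremalConnection_apply V Y x), torsion_leviCivita]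
  exact zero_add _

omit [FiniteDimensional ℝ E] in
theorem contMDiffAt_starProjection_orthogonal_singleton (hV : CMDiffAt ∞ (T% V) x)
    (hVx : V x ≠ 0) (hX : CMDiffAt ∞ (T% X) x) :
    CMDiffAt ∞ (T% (fun y ↦ (ℝ ∙ V y)ᗮ.starProjection (X y))) x := by
  simp only [starProjection_orthogonal_singleton]
  exact hX.sub_section (((contMDiffAt_inner hV hX).div₀ (contMDiffAt_inner hV hV)
    (real_inner_self_pos.2 hVx).ne').smul_section hV)

theorem contMDiffAt_inner_extremalDifference
    {S : ∀ x : M, TangentSpace I x →L[ℝ] TangentSpace I x}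
    (hS : ∀ {X : ∀ x : M, TangentSpace I x}, CMDiffAt ∞ (T% X) x →
      CMDiffAt ∞ (T% (fun y ↦ S y (X y))) x)
    (hV : CMDiffAt ∞ (T% V) x) (hVx : V x ≠ 0) (hX : CMDiffAt ∞ (T% X) x)
    (hY : CMDiffAt ∞ (T% Y) x) (hZ : CMDiffAt ∞ (T% Z) x) :
    CMDiffAt ∞ (fun y ↦ inner ℝ (extremalDifference (V y) (S y) (Y y) (X y)) (Z y)) x := by
  have hPY := contMDiffAt_starProjection_orthogonal_singleton hV hVx hY
  have hPZ := contMDiffAt_starProjection_orthogonal_singleton hV hVx hZ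
  simp only [inner_extremalDifference]
  exact ((contMDiffAt_inner hV hV).inv₀ (real_inner_self_pos.2 hVx).ne').mul
    ((((contMDiffAt_inner (hS hX) hY).mul (contMDiffAt_inner hV hZ)).sub
      ((contMDiffAt_inner hV hY).mul (contMDiffAt_inner (hS hX) hZ))).sub
      (((contMDiffAt_inner hV hX).div_const 2).mul
        ((contMDiffAt_inner (hS hPY) hPZ).sub (contMDiffAt_inner (hS hPZ) hPY))))

theorem contMDiffCovariantDerivative_extremalConnection [T2Space M]
    (hV : ∀ x, CMDiffAt ∞ (T% V) x) (hV0 : ∀ x, V x ≠ 0) :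
    (extremalConnection V).ContMDiffCovariantDerivative ∞ where
  contMDiff :=
    { contMDiff := fun {Y} hY x _ ↦ by
        have hY (y) : CMDiffAt ∞ (T% Y) y := (hY.contMDiffAt Filter.univ_mem).of_le (by simp)
        have leviCivita_smooth {Y X : ∀ x : M, TangentSpace I x}
            (hY : ∀ y, CMDiffAt ∞ (T% Y) y) (hX : CMDiffAt ∞ (T% X) x) :
            CMDiffAt ∞ (T% (fun y ↦ leviCivita I M Y y (X y))) x :=
          ContMDiffAt.clm_bundle_apply (contMDiffAt_covariantDerivative
            contMDiffCovariantDerivative_leviCivita (Filter.Eventually.of_forall hY)) hX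
        let b := Module.finBasis ℝ E
        have frame_smooth (i) := contMDiffAt_localFrame_of_mem (I := I) ∞
          (trivializationAt E (fun x : M ↦ TangentSpace I x) x) b i
          (FiberBundle.mem_baseSet_trivializationAt E _ x)
        refine ContMDiffAt.contMDiffWithinAt (contMDiffAt_hom_of_localFrame b fun i ↦
          contMDiffAt_of_inner_localFrame (V := fun x : M ↦ TangentSpace I x) b fun j ↦ ?_)
        simp only [extremalConnection_apply, add_apply, inner_add_left]
        exact (contMDiffAt_inner (leviCivita_smooth hY (frame_smooth i)) (frame_smooth j)).add
          (contMDiffAt_inner_extremalDifference (leviCivita_smooth hV) (hV x) (hV0 x)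
            (frame_smooth i) (hY x) (frame_smooth j)) }

end ExtremalConnection

/-! ### Extremality -/

section Extremal

variable {n : ℕ} {M : Type*} [TopologicalSpace M] [ChartedSpace (EuclideanSpace ℝ (Fin n)) M]
  [IsManifold (𝓡 n) ∞ M] [RiemannianBundle (fun x : M ↦ TangentSpace (𝓡 n) x)]

theorem torsionNorm_eq (nabla : LinConn n M) (x : M) :
    torsionNorm nabla x = √(∑ i, ∑ j ∈ Finset.Ioi i,
      ‖nabla.torsion x (stdOrthonormalBasis ℝ (TangentSpace (𝓡 n) x) i)
        (stdOrthonormalBasis ℝ (TangentSpace (𝓡 n) x) j)‖ ^ 2) := by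
  simp only [torsionNorm, OrthonormalBasis.sum_sq_inner_left]

variable [IsContMDiffRiemannianBundle (𝓡 n) ∞ (EuclideanSpace ℝ (Fin n))
    (fun x : M ↦ TangentSpace (𝓡 n) x)] [T2Space M]
  {β : ∀ x : M, TangentSpace (𝓡 n) x →L[ℝ] ℝ} {F : TangentBundle (𝓡 n) M → ℝ}
  {nabla nabla' : LinConn n M} {x : M} {r : ℝ}

theorem IsRandersMetric.isDifferenceTensor (hF : IsRandersMetric F β) (h : IsCompatible nabla F)
    (h' : IsCompatible nabla' F) (x : M) :
    IsDifferenceTensor (sharp β x) (nabla'.difference nabla x) where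
  skew := inner_difference_skew (h.isMetricCompatible hF) (h'.isMetricCompatible hF)
  apply_eq_zero := by
    rw [difference_apply (hF.mdifferentiableAt_sharp x), h.apply_sharp hF, h'.apply_sharp hF,
      sub_zero]

theorem IsExtremalTensor.torsionNorm_sq_add (hT : IsExtremalTensor (sharp β x) (nabla.torsion x))
    (hF : IsRandersMetric F β) (h : IsCompatible nabla F) (h' : IsCompatible nabla' F) :
    torsionNorm nabla' x ^ 2 = torsionNorm nabla x ^ 2 +
      ∑ i, ∑ j ∈ Finset.Ioi i,
        ‖nabla'.difference nabla x (stdOrthonormalBasis ℝ (TangentSpace (𝓡 n) x) j)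
            (stdOrthonormalBasis ℝ (TangentSpace (𝓡 n) x) i) -
          nabla'.difference nabla x (stdOrthonormalBasis ℝ (TangentSpace (𝓡 n) x) i)
            (stdOrthonormalBasis ℝ (TangentSpace (𝓡 n) x) j)‖ ^ 2 := by
  rw [torsionNorm_eq, torsionNorm_eq, Real.sq_sqrt (by positivity), Real.sq_sqrt (by positivity),
    ← hT.sum_Ioi_norm_sq_add _ nabla.torsion_antisymm (hF.isDifferenceTensor h h' x)]
  simp only [← torsion_eq_add_difference]

theorem IsExtremalTensor.torsionNorm_le (hT : IsExtremalTensor (sharp β x) (nabla.torsion x))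
    (hF : IsRandersMetric F β) (h : IsCompatible nabla F) (h' : IsCompatible nabla' F) :
    torsionNorm nabla x ≤ torsionNorm nabla' x := by
  refine le_of_sq_le_sq ?_ (Real.sqrt_nonneg _)
  rw [hT.torsionNorm_sq_add hF h h']
  exact le_add_of_nonneg_right (by positivity)

theorem IsExtremalTensor.difference_eq_zero
    (hT : IsExtremalTensor (sharp β x) (nabla.torsion x)) (hF : IsRandersMetric F β)
    (h : IsCompatible nabla F) (h' : IsCompatible nabla' F)
    (hle : torsionNorm nabla' x ≤ torsionNorm nabla x) : nabla'.difference nabla x = 0 := by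
  refine (hF.isDifferenceTensor h h' x).eq_zero_of_sum_Ioi_eq_zero
    (stdOrthonormalBasis ℝ (TangentSpace (𝓡 n) x)) (le_antisymm ?_ (by positivity))
  have hsq : torsionNorm nabla' x ^ 2 ≤ torsionNorm nabla x ^ 2 :=
    pow_le_pow_left₀ (Real.sqrt_nonneg _) hle 2
  rw [hT.torsionNorm_sq_add hF h h'] at hsq
  linarith

theorem IsRandersMetric.isCompatible_extremalConnection (hF : IsRandersMetric F β) (hr0 : 0 < r)
    (hr : ∀ x, ‖sharp β x‖ = r) : IsCompatible (extremalConnection (sharp β)) F :=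
  have hne (x) : sharp β x ≠ 0 := norm_pos_iff.1 (hr0.trans_eq (hr x).symm)
  hF.isCompatible (contMDiffCovariantDerivative_extremalConnection
    (fun x ↦ contMDiffAt_sharp (hF.smooth_form x)) hne) (isMetricCompatible_extremalConnection _)
    fun x ↦ extremalConnection_self (hF.mdifferentiableAt_sharp x) hr (hne x)

omit [T2Space M] in
theorem IsRandersMetric.isExtremalTensor_extremalConnection (hF : IsRandersMetric F β)
    (hr0 : 0 < r) (hr : ∀ x, ‖sharp β x‖ = r) (x : M) :
    IsExtremalTensor (sharp β x) ((extremalConnection (sharp β)).torsion x) :=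
  RandersGB.isExtremalTensor_extremalConnection (hF.mdifferentiableAt_sharp x) hr
    (norm_pos_iff.1 (hr0.trans_eq (hr x).symm))

theorem IsRandersMetric.isExtremal_extremalConnection (hF : IsRandersMetric F β) (hr0 : 0 < r)
    (hr : ∀ x, ‖sharp β x‖ = r) : IsExtremal (extremalConnection (sharp β)) F where
  compatible := hF.isCompatible_extremalConnection hr0 hr
  minimal _ h' x := (hF.isExtremalTensor_extremalConnection hr0 hr x).torsionNorm_le hF
    (hF.isCompatible_extremalConnection hr0 hr) h'

theorem IsExtremal.difference_eq_zero (h : IsExtremal nabla F) (hF : IsRandersMetric F β)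
    (hr0 : 0 < r) (hr : ∀ x, ‖sharp β x‖ = r) (x : M) :
    nabla.difference (extremalConnection (sharp β)) x = 0 :=
  have hc := hF.isCompatible_extremalConnection hr0 hr
  (hF.isExtremalTensor_extremalConnection hr0 hr x).difference_eq_zero hF hc h.compatible
    (h.minimal _ hc x)

theorem IsExtremal.apply_eq (h : IsExtremal nabla F) (hF : IsRandersMetric F β) (hr0 : 0 < r)
    (hr : ∀ x, ‖sharp β x‖ = r) {Y : ∀ x : M, TangentSpace (𝓡 n) x}
    (hY : MDifferentiableAt (𝓡 n) (𝓡 n).tangent (T% Y) x) :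
    nabla Y x = extremalConnection (sharp β) Y x := by
  rw [← sub_eq_zero, ← difference_apply hY, h.difference_eq_zero hF hr0 hr, zero_apply]

theorem IsExtremal.isExtremalTensor (h : IsExtremal nabla F) (hF : IsRandersMetric F β)
    (hr0 : 0 < r) (hr : ∀ x, ‖sharp β x‖ = r) (x : M) :
    IsExtremalTensor (sharp β x) (nabla.torsion x) := by
  have htorsion : nabla.torsion x = (extremalConnection (sharp β)).torsion x := by
    refine ContinuousLinearMap.ext fun u ↦ ContinuousLinearMap.ext fun v ↦ ?_
    rw [torsion_eq_add_difference (extremalConnection (sharp β)) nabla,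
      h.difference_eq_zero hF hr0 hr]
    exact add_eq_left.2 (sub_self 0)
  rw [htorsion]
  exact hF.isExtremalTensor_extremalConnection hr0 hr x

end Extremal

/-! ### Connection parameters in coordinates -/

section Components

variable {n : ℕ} {M : Type*} [TopologicalSpace M] [ChartedSpace (EuclideanSpace ℝ (Fin n)) M]
  {e : OpenPartialHomeomorph M (EuclideanSpace ℝ (Fin n))} {p : M}

theorem coord_eq_inner [RiemannianBundle (fun x : M ↦ TangentSpace (𝓡 n) x)]
    (he : e ∈ IsManifold.maximalAtlas (𝓡 n) ∞ M) (hp : p ∈ e.source)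
    (ho : Orthonormal ℝ (fun i ↦ coordField e i p)) (w : TangentSpace (𝓡 n) p) (k : Fin n) :
    coord e w k = inner ℝ w (coordField e k p) := by
  conv_rhs => rw [← sum_coord_smul he hp w]
  exact (ho.inner_left_fintype _ k).symm

variable [IsManifold (𝓡 n) ∞ M] {nabla nabla' : LinConn n M}

theorem torsionComp_eq (nabla : LinConn n M) (he : e ∈ IsManifold.maximalAtlas (𝓡 n) ∞ M)
    (hp : p ∈ e.source) (i j k : Fin n) :
    torsionComp e nabla i j k p = connParam e nabla i j k p - connParam e nabla j i k p := by
  rw [torsionComp, nabla.torsion_apply (mdifferentiableAt_coordField he hp i)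
    (mdifferentiableAt_coordField he hp j), mlieBracket_coordField he hp, sub_zero]
  exact coord_sub _ _ k

theorem connParam_symm (hnabla : nabla.torsion = 0)
    (he : e ∈ IsManifold.maximalAtlas (𝓡 n) ∞ M) (hp : p ∈ e.source) (i j k : Fin n) :
    connParam e nabla i j k p = connParam e nabla j i k p := by
  rw [← sub_eq_zero, ← torsionComp_eq nabla he hp, torsionComp, hnabla]
  exact map_zero (coordForm e p k)

variable [RiemannianBundle (fun x : M ↦ TangentSpace (𝓡 n) x)]
  [IsContMDiffRiemannianBundle (𝓡 n) ∞ (EuclideanSpace ℝ (Fin n))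
    (fun x : M ↦ TangentSpace (𝓡 n) x)]

theorem connParam_sub_skew (hmetric : nabla.IsMetricCompatible)
    (hmetric' : nabla'.IsMetricCompatible) (he : e ∈ IsManifold.maximalAtlas (𝓡 n) ∞ M)
    (hp : p ∈ e.source) (ho : Orthonormal ℝ (fun i ↦ coordField e i p)) (i j k : Fin n) :
    connParam e nabla' i j k p - connParam e nabla i j k p =
      -(connParam e nabla' i k j p - connParam e nabla i k j p) := by
  have hskew := inner_difference_skew hmetric hmetric' (coordField e i p) (coordField e j p)
    (coordField e k p)
  rw [difference_apply (mdifferentiableAt_coordField he hp j),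
    difference_apply (mdifferentiableAt_coordField he hp k), sub_apply, sub_apply,
    inner_sub_left, inner_sub_left] at hskew
  simpa only [connParam, coord_eq_inner he hp ho] using hskew

theorem connParam_eq {D : LinConn n M} (hmetric : nabla.IsMetricCompatible)
    (hD : IsLeviCivita D) (he : e ∈ IsManifold.maximalAtlas (𝓡 n) ∞ M) (hp : p ∈ e.source)
    (ho : Orthonormal ℝ (fun i ↦ coordField e i p)) (i j r : Fin n) :
    connParam e nabla i j r p = connParam e D i j r p -
      1 / 2 * (torsionComp e nabla j r i p + torsionComp e nabla i r j p -
        torsionComp e nabla i j r p) := by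
  have skew := connParam_sub_skew hD.metric hmetric he hp ho
  have symm := connParam_symm hD.torsion_free he hp
  simp only [torsionComp_eq nabla he hp]
  linarith [skew i j r, skew j i r, skew r i j, symm i j r, symm i r j, symm j r i]

theorem partialDeriv_inner_coordField (hmetric : nabla.IsMetricCompatible)
    (he : e ∈ IsManifold.maximalAtlas (𝓡 n) ∞ M) (hp : p ∈ e.source)
    {V : ∀ x : M, TangentSpace (𝓡 n) x}
    (hV : MDifferentiableAt (𝓡 n) (𝓡 n).tangent (T% V) p) (hVp : nabla V p = 0) (i j : Fin n) :
    partialDeriv e i (fun x ↦ inner ℝ (V x) (coordField e j x)) p =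
      inner ℝ (V p) (nabla (coordField e j) p (coordField e i p)) := by
  have hj := mdifferentiableAt_coordField he hp j
  rw [partialDeriv_eq he hp i (mdifferentiableAt_inner hV hj),
    hmetric.mvfderiv_inner_eq (coordField e i) hV hj]
  simp only [hVp, zero_apply, inner_zero_left, zero_add]

end Components

/-! ### Adapted coordinates -/

namespace IsAdapted

variable {m : ℕ} {M : Type*} [TopologicalSpace M]
  [ChartedSpace (EuclideanSpace ℝ (Fin (m + 1))) M] [IsManifold (𝓡 (m + 1)) ∞ M]
  [RiemannianBundle (fun x : M ↦ TangentSpace (𝓡 (m + 1)) x)]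
  {F : TangentBundle (𝓡 (m + 1)) M → ℝ} {β : ∀ x : M, TangentSpace (𝓡 (m + 1)) x →L[ℝ] ℝ}
  {nabla D : LinConn (m + 1) M} {e : OpenPartialHomeomorph M (EuclideanSpace ℝ (Fin (m + 1)))}
  {p : M}

theorem sharp_eq (h : IsAdapted e β p) :
    sharp β p = formComp e β (Fin.last m) p • coordField e (Fin.last m) p := by
  have hcoord (k) : coord e (sharp β p) k = formComp e β k p := by
    rw [coord_eq_inner h.mem_atlas h.mem_source h.orthonormal, inner_sharp, formComp]
  conv_lhs => rw [← sum_coord_smul h.mem_atlas h.mem_source (sharp β p), Fin.sum_univ_castSucc]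
  simp only [hcoord, h.formComp_eq_zero, zero_smul, Finset.sum_const_zero, zero_add]

theorem inner_sharp_castSucc (h : IsAdapted e β p) (a : Fin m) :
    inner ℝ (sharp β p) (coordField e a.castSucc p) = 0 :=
  (inner_sharp β p _).trans (h.formComp_eq_zero a)

theorem torsionComp_castSucc (h : IsAdapted e β p)
    (hT : IsExtremalTensor (sharp β p) (nabla.torsion p)) (a b c : Fin m) :
    torsionComp e nabla a.castSucc b.castSucc c.castSucc p = 0 := by
  rw [torsionComp, coord_eq_inner h.mem_atlas h.mem_source h.orthonormal]
  exact hT.inner_eq_zero _ _ _ (h.inner_sharp_castSucc a) (h.inner_sharp_castSucc b)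
    (h.inner_sharp_castSucc c)

theorem torsionComp_castSucc_last_symm (h : IsAdapted e β p)
    (hT : IsExtremalTensor (sharp β p) (nabla.torsion p)) (a c : Fin m) :
    torsionComp e nabla a.castSucc (Fin.last m) c.castSucc p =
      torsionComp e nabla c.castSucc (Fin.last m) a.castSucc p := by
  have hsymm := hT.inner_symm _ _ (h.inner_sharp_castSucc a) (h.inner_sharp_castSucc c)
  rw [h.sharp_eq] at hsymm
  simp only [map_smul, smul_apply, real_inner_smul_left, mul_eq_mul_left_iff,
    h.formComp_last_ne_zero, or_false] at hsymm
  rw [nabla.torsion_antisymm, nabla.torsion_antisymm (coordField e (Fin.last m) p),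
    inner_neg_left, inner_neg_left, neg_inj] at hsymm
  simpa only [torsionComp, coord_eq_inner h.mem_atlas h.mem_source h.orthonormal] using hsymm

variable [T2Space M]
  [IsContMDiffRiemannianBundle (𝓡 (m + 1)) ∞ (EuclideanSpace ℝ (Fin (m + 1)))
    (fun x : M ↦ TangentSpace (𝓡 (m + 1)) x)]

theorem partialDeriv_formComp (h : IsAdapted e β p) (hF : IsRandersMetric F β)
    (hc : IsCompatible nabla F) (i j : Fin (m + 1)) :
    partialDeriv e i (formComp e β j) p =
      formComp e β (Fin.last m) p * connParam e nabla i j (Fin.last m) p := by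
  have hform : formComp e β j = fun x ↦ inner ℝ (sharp β x) (coordField e j x) :=
    funext fun x ↦ (inner_sharp β x _).symm
  rw [hform, partialDeriv_inner_coordField (hc.isMetricCompatible hF) h.mem_atlas h.mem_source
    (hF.mdifferentiableAt_sharp p) (hc.apply_sharp hF p), h.sharp_eq, real_inner_smul_left,
    real_inner_comm, connParam, coord_eq_inner h.mem_atlas h.mem_source h.orthonormal]

theorem torsionComp_last (h : IsAdapted e β p) (hF : IsRandersMetric F β)
    (hc : IsCompatible nabla F) (i j : Fin (m + 1)) :
    torsionComp e nabla i j (Fin.last m) p = 1 / formComp e β (Fin.last m) p *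
      (partialDeriv e i (formComp e β j) p - partialDeriv e j (formComp e β i) p) := by
  have hβ := h.formComp_last_ne_zero
  rw [torsionComp_eq nabla h.mem_atlas h.mem_source, h.partialDeriv_formComp hF hc,
    h.partialDeriv_formComp hF hc]
  field_simp

theorem torsionComp_castSucc_last_last (h : IsAdapted e β p) (hF : IsRandersMetric F β)
    (hc : IsCompatible nabla F) (hD : IsLeviCivita D) (a : Fin m) :
    torsionComp e nabla a.castSucc (Fin.last m) (Fin.last m) p =
      connParam e D a.castSucc (Fin.last m) (Fin.last m) p -
        1 / formComp e β (Fin.last m) p *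
          partialDeriv e (Fin.last m) (formComp e β a.castSucc) p := by
  have hskew := connParam_sub_skew hD.metric (hc.isMetricCompatible hF) h.mem_atlas h.mem_source
    h.orthonormal a.castSucc (Fin.last m) (Fin.last m)
  rw [torsionComp_eq nabla h.mem_atlas h.mem_source, h.partialDeriv_formComp hF hc, one_div,
    inv_mul_cancel_left₀ h.formComp_last_ne_zero]
  linarith

theorem torsionComp_castSucc_last_castSucc (h : IsAdapted e β p) (hF : IsRandersMetric F β)
    (hc : IsCompatible nabla F) (hT : IsExtremalTensor (sharp β p) (nabla.torsion p))
    (hD : IsLeviCivita D) (a c : Fin m) :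
    torsionComp e nabla a.castSucc (Fin.last m) c.castSucc p =
      connParam e D a.castSucc c.castSucc (Fin.last m) p -
        1 / (2 * formComp e β (Fin.last m) p) *
          (partialDeriv e a.castSucc (formComp e β c.castSucc) p +
            partialDeriv e c.castSucc (formComp e β a.castSucc) p) := by
  have hβ := h.formComp_last_ne_zero
  have skew := connParam_sub_skew hD.metric (hc.isMetricCompatible hF) h.mem_atlas h.mem_source
    h.orthonormal
  have symm := connParam_symm hD.torsion_free h.mem_atlas h.mem_source
  have hTsymm := h.torsionComp_castSucc_last_symm hT a c
  have hmean : 1 / (2 * formComp e β (Fin.last m) p) *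
      (partialDeriv e a.castSucc (formComp e β c.castSucc) p +
        partialDeriv e c.castSucc (formComp e β a.castSucc) p) =
      (connParam e nabla a.castSucc c.castSucc (Fin.last m) p +
        connParam e nabla c.castSucc a.castSucc (Fin.last m) p) / 2 := by
    rw [h.partialDeriv_formComp hF hc, h.partialDeriv_formComp hF hc]
    field_simp
  rw [hmean]
  simp only [torsionComp_eq nabla h.mem_atlas h.mem_source] at hTsymm ⊢
  linarith [skew a.castSucc c.castSucc (Fin.last m), skew c.castSucc a.castSucc (Fin.last m),
    skew (Fin.last m) a.castSucc c.castSucc, symm a.castSucc c.castSucc (Fin.last m),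
    symm a.castSucc (Fin.last m) c.castSucc, symm c.castSucc (Fin.last m) a.castSucc]

theorem torsionComp_castSucc_last_self (h : IsAdapted e β p) (hF : IsRandersMetric F β)
    (hc : IsCompatible nabla F) (hT : IsExtremalTensor (sharp β p) (nabla.torsion p))
    (hD : IsLeviCivita D) (a : Fin m) :
    torsionComp e nabla a.castSucc (Fin.last m) a.castSucc p =
      connParam e D a.castSucc a.castSucc (Fin.last m) p -
        1 / formComp e β (Fin.last m) p *
          partialDeriv e a.castSucc (formComp e β a.castSucc) p := by
  rw [h.torsionComp_castSucc_last_castSucc hF hc hT hD]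
  field

end IsAdapted

end RandersGB

end

/-- The dimension is `m + 1`: the indices `1, …, n - 1` of the text are `a.castSucc` with
`a : Fin m`, and the index `n` is `Fin.last m`. -/
theorem theorem1 {m : ℕ} {M : Type*} [TopologicalSpace M] [T2Space M] [ConnectedSpace M]
    [ChartedSpace (EuclideanSpace ℝ (Fin (m + 1))) M] [IsManifold (𝓡 (m + 1)) ∞ M]
    [RiemannianBundle (fun x : M ↦ TangentSpace (𝓡 (m + 1)) x)]
    [IsContMDiffRiemannianBundle (𝓡 (m + 1)) ∞ (EuclideanSpace ℝ (Fin (m + 1)))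
      (fun x : M ↦ TangentSpace (𝓡 (m + 1)) x)]
    (F : TangentBundle (𝓡 (m + 1)) M → ℝ)
    (β : ∀ x : M, TangentSpace (𝓡 (m + 1)) x →L[ℝ] ℝ)
    (hF : IsRandersMetric F β)
    (hnR : ¬ IsRiemannianNorm F) :
    -- existence of a compatible linear connection
    ((∃ nabla : LinConn (m + 1) M, IsCompatible nabla F) ↔
      ∃ L : ℝ, 0 < L ∧ ∀ x : M, ‖sharp β x‖ = L) ∧
    -- in that case the extremal compatible linear connection exists and is unique
    ((∃ nabla : LinConn (m + 1) M, IsCompatible nabla F) →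
      ∃ nabla : LinConn (m + 1) M, IsExtremal nabla F) ∧
    (∀ nabla nabla' : LinConn (m + 1) M,
      IsExtremal nabla F → IsExtremal nabla' F →
      ∀ (x : M) (Y : ∀ x : M, TangentSpace (𝓡 (m + 1)) x),
        MDifferentiableAt (𝓡 (m + 1)) (𝓡 (m + 1)).tangent
          (fun y ↦ (⟨y, Y y⟩ : TangentBundle (𝓡 (m + 1)) M)) x →
        nabla Y x = nabla' Y x) ∧
    -- its connection parameters and torsion components in adapted coordinates
    ∀ nabla D : LinConn (m + 1) M,
      IsExtremal nabla F → IsLeviCivita D →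
      ∀ (p : M) (e : OpenPartialHomeomorph M (EuclideanSpace ℝ (Fin (m + 1)))),
        IsAdapted e β p →
        (∀ i j r, connParam e nabla i j r p = connParam e D i j r p -
          1 / 2 * (torsionComp e nabla j r i p + torsionComp e nabla i r j p -
            torsionComp e nabla i j r p)) ∧
        -- front short blocks
        (∀ a b c : Fin m, a < b →
          torsionComp e nabla a.castSucc b.castSucc c.castSucc p = 0) ∧
        -- front tails
        (∀ a b : Fin m, a < b → torsionComp e nabla a.castSucc b.castSucc (Fin.last m) p =
          1 / formComp e β (Fin.last m) p *
            (partialDeriv e a.castSucc (formComp e β b.castSucc) p -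
              partialDeriv e b.castSucc (formComp e β a.castSucc) p)) ∧
        -- rear diagonal elements
        (∀ a : Fin m, torsionComp e nabla a.castSucc (Fin.last m) a.castSucc p =
          connParam e D a.castSucc a.castSucc (Fin.last m) p -
            1 / formComp e β (Fin.last m) p *
              partialDeriv e a.castSucc (formComp e β a.castSucc) p) ∧
        -- rear tails
        (∀ a : Fin m, torsionComp e nabla a.castSucc (Fin.last m) (Fin.last m) p =
          connParam e D a.castSucc (Fin.last m) (Fin.last m) p -
            1 / formComp e β (Fin.last m) p *
              partialDeriv e (Fin.last m) (formComp e β a.castSucc) p) ∧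
        -- non-diagonal elements of the rear short blocks
        (∀ a c : Fin m, a ≠ c → torsionComp e nabla a.castSucc (Fin.last m) c.castSucc p =
          connParam e D a.castSucc c.castSucc (Fin.last m) p -
            1 / (2 * formComp e β (Fin.last m) p) *
              (partialDeriv e a.castSucc (formComp e β c.castSucc) p +
                partialDeriv e c.castSucc (formComp e β a.castSucc) p)) := by
  have norm_sharp_eq {nabla : LinConn (m + 1) M} (h : IsCompatible nabla F) :
      ∃ L : ℝ, 0 < L ∧ ∀ x : M, ‖sharp β x‖ = L := h.exists_norm_sharp_eq hF hnR
  refine ⟨⟨fun ⟨nabla, h⟩ ↦ norm_sharp_eq h,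
      fun ⟨L, hL0, hL⟩ ↦ ⟨_, hF.isCompatible_extremalConnection hL0 hL⟩⟩,
    fun ⟨nabla, h⟩ ↦ ?_, fun nabla nabla' h h' x Y hY ↦ ?_, fun nabla D h hD p e he ↦ ?_⟩
  · obtain ⟨L, hL0, hL⟩ := norm_sharp_eq h
    exact ⟨_, hF.isExtremal_extremalConnection hL0 hL⟩
  · obtain ⟨L, hL0, hL⟩ := norm_sharp_eq h.compatible
    rw [h.apply_eq hF hL0 hL hY, h'.apply_eq hF hL0 hL hY]
  · obtain ⟨L, hL0, hL⟩ := norm_sharp_eq h.compatible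
    have hc := h.compatible
    have hT := h.isExtremalTensor hF hL0 hL p
    exact ⟨connParam_eq (hc.isMetricCompatible hF) hD he.mem_atlas he.mem_source he.orthonormal,
      fun a b c _ ↦ he.torsionComp_castSucc hT a b c,
      fun a b _ ↦ he.torsionComp_last hF hc a.castSucc b.castSucc,
      he.torsionComp_castSucc_last_self hF hc hT hD,
      he.torsionComp_castSucc_last_last hF hc hD,
      fun a c _ ↦ he.torsionComp_castSucc_last_castSucc hF hc hT hD a c⟩
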